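/- **Setting.** Let $Q(y|x)$ be a discrete memoryless channel with finite input alphabet $\mathcal X$ and finite output alphabet $\mathcal Y$ such that every $y\in\mathcal Y$ has $Q(y|x)>0$ for some $x$. Let $\star\in\mathcal X$ be the no-input symbol and $Q_\star=Q(\cdot|\star)$ the noise distribution. Logarithms are natural. Assume that the synchronous capacity $C=\max_P I(PQ)$ is positive. A code of length $n$ with asynchronism level $A\in\{1,2,\dots\}$ consists of $M\ge2$ codewords $c(1),\dots,c(M)\in\mathcal X^n$, a (possibly randomized) stopping time $\tau\in\{1,\dots,A+n-1\}$ with respect to the outputs $Y_1,\dots,Y_{A+n-1}$, and a decision rule $\phi$ with values in $\{1,\dots,M\}$ that is a function of $\tau$ and $Y_1,\dots,Y_\tau$. Under $\mathbb P_{m,t}$ the outputs are independent, $Y_j$ has law $Q(\cdot|c_{j-t+1}(m))$ for $t\le j\le t+n-1$, and law $Q_\star$ for all other $j$. The error probability is $\max_m\frac1A\sum_{t=1}^A\mathbb P_{m,t}(\phi\ne m)$, the delay is $\Delta=\max_m\frac1A\sum_{t=1}^A\mathbb E_{m,t}(\tau-t)^+$, and the rate is $\ln M/\Delta$ (infinite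 if $\Delta=0$). A sequence of codes, one for each length $n$, achieves $(R,\alpha)$ if for every $\epsilon>0$ and all large $n$ its level is at least $e^{(\alpha-\epsilon)n}$, its rate is at least $R-\epsilon$, and its error probability is at most $\epsilon$. It is training-based if for some $\eta\in[0,1]$ and all large $n$, (i) all codewords have the same first $\lfloor\eta n\rfloor$ symbols, and (ii) $\tau$ is a sliding-window stopping rule, or a random mixture, independent of the channel, of such rules: at each time $t$, whether to stop at $t$, given that the decoder has not stopped before (and is not forced to stop at the deadline $A+n-1$), depends only on the outputs $Y_{t-n+1},\dots,Y_{t-n+\lfloor\eta n\rfloor}$. Let $\alpha^{\mathrm T}(R)\in[0,\infty]$ be the supremum of the exponents $\alpha\ge0$ for which some training-based sequence achieves $(R,\alpha)$. Let $$\alpha_\circ=\max_x D(Q(\cdot|x)\,\|\,Q_\star),\qquad m_2=-\ln\bigl(\min_y Q_\star(y)\bigr).$$ **Corollary 4.** If $\alpha_\circ<\infty$, then $m_2<\infty$, $$\alpha^{\mathrm T}(R)\le m_2\Bigl(1-\frac RC\Bigr)\qquad\text{for all } R\in(0,C],$$ and consequently $\alpha^{\mathrm T}(R)\to0$ as $R\to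 C$ (through values $R\le C$). -/

import Mathlib

open Filter Topology
open scoped ENNReal NNReal

noncomputable section

namespace AsyncComm

/-! ### Information measures of a finite-alphabet channel

A discrete memoryless channel is a map `Q : X → PMF Y`, where `Q x y` stands for `Q(y|x)`.
All logarithms are natural. -/

/-- The divergence `D(p‖q)` of two distributions on a finite alphabet. -/
def divergence {Y : Type*} (p q : PMF Y) : ℝ≥0∞ :=
  letI : MeasurableSpace Y := ⊤
  InformationTheory.klDiv p.toMeasure q.toMeasure

/-- The mutual information `I(PQ)` between input and output for the input distribution `P`,
with the convention `0 ln (0/0) = 0`. -/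
def mutualInfo {X Y : Type*} [Fintype X] [Fintype Y] (Q : X → PMF Y) (P : PMF X) : ℝ :=
  ∑ x, (P x).toReal * ∑ y, (Q x y).toReal * Real.log ((Q x y).toReal / (P.bind Q y).toReal)

/-- The capacity `C` of the synchronous channel: the largest mutual information. -/
def capacity {X Y : Type*} [Fintype X] [Fintype Y] (Q : X → PMF Y) : ℝ :=
  ⨆ P : PMF X, mutualInfo Q P

/-- The synchronization threshold `α∘ = max_x D(Q(·|x)‖Q(·|⋆))`. -/
def syncThreshold {X Y : Type*} (Q : X → PMF Y) (star : X) : ℝ≥0∞ :=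
  ⨆ x, divergence (Q x) (Q star)

/-- The constant `m₂ = -ln (min_y Q(y|⋆))`; it is `⊤` when some `Q(y|⋆)` vanishes. -/
def m₂ {X Y : Type*} (Q : X → PMF Y) (star : X) : EReal :=
  -ENNReal.log (⨅ y, Q star y)

/-! ### Codes -/

/-- A code of block length `n` for the asynchronous channel, together with the asynchronism level
at which it operates. The receiver observes `Y_1, …, Y_{A+n-1}`; the symbol `Y_j` is the
coordinate `j - 1` of a sequence indexed by `Fin (A + n - 1)`.

The stopping time may be randomized: it is driven by a random seed that is independent of
everything else. Alphabet and horizon are finite, so that there are finitely many deterministic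
stopping times and a seed with finitely many values is no restriction. -/
structure Code (X Y : Type*) (n : ℕ) where
  /-- the number of messages -/
  M : ℕ
  two_le_M : 2 ≤ M
  /-- the asynchronism level -/
  A : ℕ
  one_le_A : 1 ≤ A
  /-- the codewords -/
  codeword : Fin M → Fin n → X
  /-- the number of values of the seed -/
  K : ℕ
  /-- the law of the seed -/
  seedLaw : PMF (Fin K)
  /-- the stopping time, for each value of the seed -/
  τ : Fin K → (Fin (A + n - 1) → Y) → ℕ
  one_le_τ : ∀ u y, 1 ≤ τ u y
  τ_le : ∀ u y, τ u y ≤ A + n - 1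
  /-- whether `τ = t` is determined by the first `t` outputs -/
  τ_stopping : ∀ u y y', (∀ i : Fin (A + n - 1), (i : ℕ) < τ u y → y' i = y i) → τ u y' = τ u y
  /-- the message that is declared when the decoder stops at time `t` having seen `Y_1, …, Y_t` -/
  φ : ℕ → (Fin (A + n - 1) → Y) → Fin M
  φ_adapted : ∀ t y y', (∀ i : Fin (A + n - 1), (i : ℕ) < t → y' i = y i) → φ t y' = φ t y

namespace Code

variable {X Y : Type*} {n : ℕ}

/-- The channel input over the whole horizon when message `m` starts being sent at time `t`: the
codeword at the times `t, …, t + n - 1`, and the no-input symbol `⋆` at all other times. -/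
def input (c : Code X Y n) (star : X) (m : Fin c.M) (t : ℕ) (i : Fin (c.A + n - 1)) : X :=
  if h : t ≤ (i : ℕ) + 1 ∧ (i : ℕ) + 1 < t + n then
    c.codeword m ⟨(i : ℕ) + 1 - t, by omega⟩
  else star

/-- The expectation under `ℙ_{m,t}` of a function `f` of the seed and of the channel outputs. -/
def expect [Fintype Y] (c : Code X Y n) (Q : X → PMF Y) (star : X) (m : Fin c.M) (t : ℕ)
    (f : Fin c.K → (Fin (c.A + n - 1) → Y) → ℝ) : ℝ :=
  ∑ u, (c.seedLaw u).toReal *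
    ∑ y : Fin (c.A + n - 1) → Y, (∏ i, (Q (c.input star m t i) (y i)).toReal) * f u y

open Classical in
/-- The maximum over messages of the time-averaged decoding error probability. -/
def errorProb [Fintype Y] (c : Code X Y n) (Q : X → PMF Y) (star : X) : ℝ :=
  ⨆ m : Fin c.M, (1 / (c.A : ℝ)) * ∑ t ∈ Finset.Icc 1 c.A,
    c.expect Q star m t (fun u y => if c.φ (c.τ u y) y ≠ m then 1 else 0)

/-- The delay `Δ`: the maximum over messages of the time average of `𝔼_{m,t} (τ - t)⁺`. -/
def delay [Fintype Y] (c : Code X Y n) (Q : X → PMF Y) (star : X) : ℝ :=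
  ⨆ m : Fin c.M, (1 / (c.A : ℝ)) * ∑ t ∈ Finset.Icc 1 c.A,
    c.expect Q star m t (fun u y => max 0 ((c.τ u y : ℝ) - (t : ℝ)))

/-- All codewords have the same first `k` symbols. -/
def HasCommonPreamble (c : Code X Y n) (k : ℕ) : Prop :=
  ∀ (m m' : Fin c.M) (i : Fin n), (i : ℕ) < k → c.codeword m i = c.codeword m' i

/-- At every time `t` the decision to stop at `t`, when the decoder has not stopped before, depends
on the outputs only through the `k` symbols `Y_{t-n+1}, …, Y_{t-n+k}` (those of them whose index
is at least `1`). -/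
def HasWindowStopping (c : Code X Y n) (k : ℕ) : Prop :=
  ∀ (u : Fin c.K) (t : ℕ) (y y' : Fin (c.A + n - 1) → Y),
    (∀ i : Fin (c.A + n - 1), t ≤ (i : ℕ) + n → (i : ℕ) + n < t + k → y i = y' i) →
    t ≤ c.τ u y → t ≤ c.τ u y' → (c.τ u y = t ↔ c.τ u y' = t)

end Code

/-! ### Coding schemes and the capacity restricted to training-based schemes -/

/-- The sequence of codes achieves the rate `R` at the asynchronism exponent `α`: for every `ε > 0`
and all large `n`, the asynchronism level is at least `e^{(α-ε)n}`, the rate `ln M / Δ` is at least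
`R - ε` (the rate is infinite when `Δ = 0`), and the error probability is at most `ε`. -/
def Achieves {X Y : Type*} [Fintype Y] (Q : X → PMF Y) (star : X)
    (c : ∀ n, Code X Y n) (R α : ℝ) : Prop :=
  ∀ ε : ℝ, 0 < ε → ∀ᶠ n : ℕ in atTop,
    Real.exp ((α - ε) * n) ≤ (c n).A ∧
    (R - ε) * (c n).delay Q star ≤ Real.log (c n).M ∧
    (c n).errorProb Q star ≤ ε

/-- The sequence of codes is training-based, with the fraction `η` of each codeword allocated to
the preamble. -/
def IsTrainingBased {X Y : Type*} (c : ∀ n, Code X Y n) : Prop :=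
  ∃ η : ℝ, 0 ≤ η ∧ η ≤ 1 ∧ ∀ᶠ n : ℕ in atTop,
    (c n).HasCommonPreamble ⌊η * n⌋₊ ∧ (c n).HasWindowStopping ⌊η * n⌋₊

/-- The asynchronous capacity restricted to training-based schemes, `α^T(R)`: the supremum in
`[0, ∞]` of the asynchronism exponents `α ≥ 0` that training-based schemes achieve at rate `R`. -/
def trainingCapacity {X Y : Type*} [Fintype Y] (Q : X → PMF Y) (star : X) (R : ℝ) : ℝ≥0∞ :=
  ⨆ (α : ℝ≥0) (_ : ∃ c : ∀ n, Code X Y n, IsTrainingBased c ∧ Achieves Q star c R α), (α : ℝ≥0∞)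

end AsyncComm

end

/-! Let k = ⌊ηn⌋ be the length of the preamble and μ = m₂. The theorem combines α ≤ μη with R ≤ C(1
- η), the latter for η > 0.

Exponent (`Achieves.exponent_le`). A pattern that makes a sliding-window rule stop consists of at
most k outputs, so pure noise produces it with probability at least e^{-μk}. Every time at which
stopping is possible thus carries a risk of false alarm, and the probabilities of surviving the
noise until these times sum to at most n e^{μk} (`HasWindowStopping.sum_noiseSurvival_le`). Stopping
within [t, t+L] requires surviving until such a time, so the probabilities of this event sum over t
to at most (L+1) n e^{μk}. Small error and a delay linear in n force this sum to be of order A for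
some L linear in n. Hence A is at most a polynomial times e^{μηn}.

Rate (`Achieves.rate_le`). The window ends n - k time units before the present. While the message
part of the codeword arrives, the decision to go on depends only on outputs that precede this part,
so its probability is the same for all messages. Fano's inequality for stopped outputs
(`log_card_mul_avg_prob_le`) then bounds (1 - error) ln M by C times the mean number of observed
message symbols, plus ln 2; that number is at most (1 - η)(τ - t)⁺ + 2. A stop inside the preamble
leaves only a guess, so Δ is at least of order k (`HasCommonPreamble.mul_le_delay`), and for η > 0
the constants are negligible against Δ. -/

noncomputable section

namespace AsyncComm

/-! ### Sums against product weights -/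

section ProductWeights

variable {ι Y : Type*} [Fintype ι] [DecidableEq ι] [Fintype Y]

/-- If `h` does not depend on the coordinates in `W`, these coordinates can be summed out. -/
theorem sum_prod_mul_eq_prod_mul_sum (W : Finset ι) (w : ι → Y → ℝ) (h : (ι → Y) → ℝ)
    (hh : DependsOn h (↑W : Set ι)ᶜ) (y₀ : ι → Y) :
    ∑ y, (∏ i, w i (y i)) * h y =
      (∏ i ∈ W, ∑ v, w i v) * ∑ b : {i // i ∉ W} → Y,
        (∏ i : {i // i ∉ W}, w i (b i)) *
        h (fun i => if hi : i ∈ W then y₀ i else b ⟨i, hi⟩) := by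
  classical
  rw [← (Equiv.piEquivPiSubtypeProd (· ∈ W) (fun _ => Y)).symm.sum_comp, Fintype.sum_prod_type]
  have h1 : (∏ i ∈ W, ∑ v, w i v) = ∑ a : {i // i ∈ W} → Y,
      ∏ i : {i // i ∈ W}, w i (a i) := by
    rw [← Finset.prod_coe_sort W (fun i => ∑ v, w i v), Finset.prod_univ_sum,
      Fintype.piFinset_univ]
  rw [h1, Finset.sum_mul_sum]
  refine Finset.sum_congr rfl fun a _ => Finset.sum_congr rfl fun b _ => ?_
  have h2 : h ((Equiv.piEquivPiSubtypeProd (· ∈ W) (fun _ => Y)).symm (a, b)) =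
      h (fun i => if hi : i ∈ W then y₀ i else b ⟨i, hi⟩) := by
    refine hh fun i hi => ?_
    have hi' : i ∉ W := by simpa using hi
    simp [Equiv.piEquivPiSubtypeProd, hi']
  rw [h2, ← mul_assoc]
  congr 1
  rw [← Fintype.prod_subtype_mul_prod_subtype (fun i => i ∈ W)]
  congr 1
  · refine Finset.prod_congr (by ext; simp) fun i _ => ?_
    simp [Equiv.piEquivPiSubtypeProd, i.2]
  · refine Finset.prod_congr rfl fun i _ => ?_
    simp [Equiv.piEquivPiSubtypeProd, i.2]

/-- Changing the weights in the coordinates on which `h` does not depend multiplies the sum by the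
product of the new totals. -/
theorem sum_prod_mul_eq_of_eq_off (W : Finset ι) (w w' : ι → Y → ℝ) (h : (ι → Y) → ℝ)
    (hh : DependsOn h (↑W : Set ι)ᶜ) (hw : ∀ i ∈ W, ∑ v, w i v = 1)
    (hww' : ∀ i ∉ W, w' i = w i) :
    ∑ y, (∏ i, w' i (y i)) * h y =
      (∏ i ∈ W, ∑ v, w' i v) * ∑ y, (∏ i, w i (y i)) * h y := by
  rcases isEmpty_or_nonempty (ι → Y) with hE | ⟨⟨y₀⟩⟩
  · simp
  · rw [sum_prod_mul_eq_prod_mul_sum W w' h hh y₀, sum_prod_mul_eq_prod_mul_sum W w h hh y₀,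
      Finset.prod_congr rfl hw, Finset.prod_const_one, one_mul]
    congr 1
    refine Finset.sum_congr rfl fun b _ => ?_
    congr 1
    exact Finset.prod_congr rfl fun (i : {i // i ∉ W}) _ => by rw [hww' i i.2]

/-- The expectation of a function depends only on the laws of the coordinates it depends on. -/
theorem sum_prod_mul_congr (S : Set ι) (w w' : ι → Y → ℝ) (h : (ι → Y) → ℝ)
    (hh : DependsOn h S) (hw : ∀ i, ∑ v, w i v = 1) (hw' : ∀ i, ∑ v, w' i v = 1)
    (hww' : ∀ i ∈ S, w' i = w i) :
    ∑ y, (∏ i, w' i (y i)) * h y = ∑ y, (∏ i, w i (y i)) * h y := by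
  classical
  rw [sum_prod_mul_eq_of_eq_off (Finset.univ.filter fun i => i ∉ S) w w' h
    (fun x y hxy => hh fun i hi => hxy i (by simpa using hi)) (fun i _ => hw i)
    (fun i hi => hww' i (by simpa using hi)),
    Finset.prod_congr rfl (fun i _ => hw' i), Finset.prod_const_one, one_mul]

theorem sum_prod_eq_one (w : ι → Y → ℝ) (hw : ∀ i, ∑ v, w i v = 1) :
    ∑ y : ι → Y, ∏ i, w i (y i) = 1 := by
  classical
  rw [← Fintype.piFinset_univ, ← Finset.prod_univ_sum, Finset.prod_congr rfl (fun i _ => hw i),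
    Finset.prod_const_one]

/-- A function of one coordinate is independent of a function of the other coordinates. -/
theorem sum_prod_mul_coord (i : ι) (w : ι → Y → ℝ) (g : Y → ℝ) (h : (ι → Y) → ℝ)
    (hh : DependsOn h {i}ᶜ) (hw : ∑ v, w i v = 1) :
    ∑ y, (∏ j, w j (y j)) * (h y * g (y i)) =
      (∑ y, (∏ j, w j (y j)) * h y) * ∑ v, w i v * g v := by
  -- The factor `g (y i)` is absorbed into the weight of the coordinate `i`; the new weight need not
  -- be normalized.
  have := sum_prod_mul_eq_of_eq_off {i} w (Function.update w i fun v => w i v * g v) h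
    (by simpa using hh) (by simpa using hw) (fun j hj => by
      rw [Function.update_of_ne (by simpa using hj)])
  rw [Finset.prod_singleton, Function.update_self] at this
  rw [mul_comm, ← this]
  refine Finset.sum_congr rfl fun y _ => ?_
  have h3 : ∏ j, Function.update w i (fun v => w i v * g v) j (y j)
      = (∏ j, w j (y j)) * g (y i) := by
    rw [Fintype.prod_eq_mul_prod_compl i, Fintype.prod_eq_mul_prod_compl i (fun j => w j (y j)),
      Function.update_self]
    rw [Finset.prod_congr rfl (g := fun j => w j (y j)) fun j hj => by
      rw [Function.update_of_ne (by simpa using hj)]]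
    ring
  rw [h3]; ring

end ProductWeights

/-! ### A converse for decoders that stop at a random time -/

section Converse

variable {Y : Type*} {N : ℕ}

/-- `τ` is a stopping time with respect to the coordinates. -/
def IsStopping (τ : (Fin N → Y) → ℕ) : Prop :=
  ∀ y y', (∀ i : Fin N, (i : ℕ) < τ y → y' i = y i) → τ y' = τ y

theorem IsStopping.dependsOn_indicator_eq {τ : (Fin N → Y) → ℕ} (hτ : IsStopping τ)
    (p : ℕ → (Fin N → Y) → Prop) [∀ s y, Decidable (p s y)]
    (hp : ∀ s y y', (∀ i : Fin N, (i : ℕ) < s → y' i = y i) → (p s y' ↔ p s y)) (s : ℕ) :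
    DependsOn (fun y => if τ y = s ∧ p s y then (1 : ℝ) else 0) {i : Fin N | (i : ℕ) < s} := by
  intro y y' h
  have h1 : τ y = s ↔ τ y' = s := by
    constructor
    · rintro rfl; exact hτ y y' fun i hi => (h i hi).symm
    · rintro rfl; exact hτ y' y fun i hi => h i hi
  have h2 := hp s y y' fun i hi => (h i hi).symm
  simp only [h1, h2]

theorem IsStopping.dependsOn_indicator_lt {τ : (Fin N → Y) → ℕ} (hτ : IsStopping τ) (s : ℕ) :
    DependsOn (fun y => if s < τ y then (1 : ℝ) else 0) {i : Fin N | (i : ℕ) < s} := by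
  intro y y' h
  have h1 : τ y ≤ s ↔ τ y' ≤ s := by
    constructor
    · intro hs; rwa [hτ y y' fun i hi => (h i (lt_of_lt_of_le hi hs)).symm]
    · intro hs; rwa [hτ y' y fun i hi => h i (lt_of_lt_of_le hi hs)]
  simp only [← not_le, h1]

variable [Fintype Y]

/-- The law of the past of a stopping time does not change when the laws of the coordinates after
that time are changed. -/
theorem sum_stopped_prod {τ : (Fin N → Y) → ℕ} (hτ : IsStopping τ)
    (p : ℕ → (Fin N → Y) → Prop) [∀ s y, Decidable (p s y)]
    (hp : ∀ s y y', (∀ i : Fin N, (i : ℕ) < s → y' i = y i) → (p s y' ↔ p s y))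
    (a b : Fin N → Y → ℝ) (ha : ∀ i, ∑ v, a i v = 1) (hb : ∀ i, ∑ v, b i v = 1) :
    ∑ y, (∏ i : Fin N, if (i : ℕ) < τ y then a i (y i) else b i (y i)) *
        (if p (τ y) y then (1 : ℝ) else 0) =
      ∑ y, (∏ i, a i (y i)) * (if p (τ y) y then (1 : ℝ) else 0) := by
  classical
  -- For fixed `s` the event `τ y = s` sees only the coordinates before `s`, where the mixed weights
  -- agree with `a`. Summing over the values of `τ` then gives the claim.
  have key : ∀ s : ℕ, ∑ y, (∏ i : Fin N, (if (i : ℕ) < s then a i else b i) (y i)) *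
      (if τ y = s ∧ p s y then (1 : ℝ) else 0) =
      ∑ y, (∏ i, a i (y i)) * (if τ y = s ∧ p s y then (1 : ℝ) else 0) := fun s =>
    sum_prod_mul_congr _ a (fun i : Fin N => if (i : ℕ) < s then a i else b i) _
      (hτ.dependsOn_indicator_eq p hp s) ha
      (fun i => by by_cases h : (i : ℕ) < s <;> simp [h, ha, hb])
      (fun i hi => by simp only [Set.mem_ofPred_eq] at hi; simp [hi])
  set T : Finset ℕ := Finset.univ.image τ
  have split : ∀ y, ∀ F : ℕ → ℝ, F (τ y) = ∑ s ∈ T, if τ y = s then F s else 0 := by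
    intro y F
    rw [Finset.sum_ite_eq, if_pos (Finset.mem_image_of_mem _ (Finset.mem_univ y))]
  calc _ = ∑ y, ∑ s ∈ T, (∏ i : Fin N, (if (i : ℕ) < s then a i else b i) (y i)) *
      (if τ y = s ∧ p s y then (1 : ℝ) else 0) := by
        refine Finset.sum_congr rfl fun y _ => ?_
        rw [split y fun s => (∏ i : Fin N, if (i : ℕ) < s then a i (y i) else b i (y i)) *
          (if p s y then (1 : ℝ) else 0)]
        refine Finset.sum_congr rfl fun s _ => ?_
        by_cases h : τ y = s
        · simp only [h, true_and, if_true]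
          congr 1
          exact Finset.prod_congr rfl fun i _ => by split_ifs <;> rfl
        · simp [h]
    _ = ∑ y, ∑ s ∈ T, (∏ i, a i (y i)) * (if τ y = s ∧ p s y then (1 : ℝ) else 0) := by
        rw [Finset.sum_comm, Finset.sum_congr rfl fun s _ => key s, Finset.sum_comm]
    _ = _ := by
        refine Finset.sum_congr rfl fun y _ => ?_
        rw [split y fun s => (∏ i : Fin N, a i (y i)) * (if p s y then (1 : ℝ) else 0)]
        refine Finset.sum_congr rfl fun s _ => ?_
        by_cases h : τ y = s <;> simp [h]

/-- Wald's identity for the log-likelihood ratio of the coordinates observed before `τ`. -/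
theorem sum_prod_mul_sum_stopped {τ : (Fin N → Y) → ℕ} (hτ : IsStopping τ)
    (w : Fin N → Y → ℝ) (hw : ∀ i, ∑ v, w i v = 1) (g : Fin N → Y → ℝ) :
    ∑ y, (∏ i, w i (y i)) * ∑ i : Fin N, (if (i : ℕ) < τ y then (1 : ℝ) else 0) * g i (y i) =
      ∑ i : Fin N, (∑ y, (∏ j, w j (y j)) * (if (i : ℕ) < τ y then (1 : ℝ) else 0)) *
        ∑ v, w i v * g i v := by
  simp_rw [Finset.mul_sum]
  rw [Finset.sum_comm]
  refine Finset.sum_congr rfl fun i _ => ?_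
  rw [sum_prod_mul_coord i w (g i) (fun y => if (i : ℕ) < τ y then (1 : ℝ) else 0)
    (fun y y' h => hτ.dependsOn_indicator_lt i fun j hj => h j (by
      simp only [Set.mem_ofPred_eq] at hj
      simp only [Set.mem_compl_iff, Set.mem_singleton_iff]
      rintro rfl; exact lt_irrefl _ hj)) (hw i), Finset.mul_sum]

/-- Fano's inequality for one hypothesis `w` against a reference law `q`, for a test that stops at
time `τ`. -/
theorem log_mul_prob_sub_divergence_le {τ : (Fin N → Y) → ℕ} (hτ : IsStopping τ)
    (p : ℕ → (Fin N → Y) → Prop) [∀ s y, Decidable (p s y)]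
    (hp : ∀ s y y', (∀ i : Fin N, (i : ℕ) < s → y' i = y i) → (p s y' ↔ p s y))
    (w q : Fin N → Y → ℝ) (hw0 : ∀ i v, 0 ≤ w i v) (hq0 : ∀ i v, 0 ≤ q i v)
    (hw : ∀ i, ∑ v, w i v = 1) (hq : ∀ i, ∑ v, q i v = 1)
    (hac : ∀ i v, w i v ≠ 0 → q i v ≠ 0) {M : ℝ} (hM : 1 ≤ M) :
    Real.log M * (∑ y, (∏ i, w i (y i)) * (if p (τ y) y then (1 : ℝ) else 0)) -
      ∑ i : Fin N, (∑ y, (∏ j, w j (y j)) * (if (i : ℕ) < τ y then (1 : ℝ) else 0)) *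
        ∑ v, w i v * Real.log (w i v / q i v) ≤
    Real.log 2 - 1 / 2 + (M - 1) / 2 *
      ∑ y, (∏ i, q i (y i)) * (if p (τ y) y then (1 : ℝ) else 0) := by
  classical
  have hpast := sum_stopped_prod hτ p hp q w hq hw
  have hpast1 := sum_stopped_prod hτ (fun _ _ => True) (by simp) q w hq hw
  simp only [if_true, mul_one, sum_prod_eq_one q hq] at hpast1
  rw [← sum_prod_mul_sum_stopped hτ w hw, ← hpast, Finset.mul_sum, ← Finset.sum_sub_distrib]
  have hone := sum_prod_eq_one w hw
  -- The mixed weights have total mass 1, so the right side becomes a sum over `y` and a pointwise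
  -- inequality suffices.
  have hrhs : Real.log 2 - 1 / 2 + (M - 1) / 2 *
      ∑ y, (∏ i : Fin N, if (i : ℕ) < τ y then q i (y i) else w i (y i)) *
        (if p (τ y) y then (1 : ℝ) else 0) =
      ∑ y, ((∏ i, w i (y i)) * (Real.log 2 - 1) +
        (∏ i : Fin N, if (i : ℕ) < τ y then q i (y i) else w i (y i)) *
        ((1 + (M - 1) * (if p (τ y) y then (1 : ℝ) else 0)) / 2)) := by
    rw [Finset.sum_add_distrib, ← Finset.sum_mul, hone]
    have : ∀ y : Fin N → Y, (∏ i : Fin N, if (i : ℕ) < τ y then q i (y i) else w i (y i)) *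
        ((1 + (M - 1) * (if p (τ y) y then (1 : ℝ) else 0)) / 2) =
        (1 / 2) * (∏ i : Fin N, if (i : ℕ) < τ y then q i (y i) else w i (y i)) + (M - 1) / 2 *
        ((∏ i : Fin N, if (i : ℕ) < τ y then q i (y i) else w i (y i)) *
          (if p (τ y) y then (1 : ℝ) else 0)) := fun y => by ring
    simp_rw [this]
    rw [Finset.sum_add_distrib, ← Finset.mul_sum, ← Finset.mul_sum, hpast1]
    ring
  rw [hrhs]
  refine Finset.sum_le_sum fun y _ => ?_
  have hR0 : 0 ≤ ∏ i : Fin N, if (i : ℕ) < τ y then q i (y i) else w i (y i) :=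
    Finset.prod_nonneg fun i _ => by split_ifs; exacts [hq0 _ _, hw0 _ _]
  have hf0 : 0 ≤ (1 + (M - 1) * (if p (τ y) y then (1 : ℝ) else 0)) / 2 := by
    split_ifs <;> linarith
  by_cases hz : ∏ i, w i (y i) = 0
  · rw [hz]
    simpa using mul_nonneg hR0 hf0
  have hpos : ∀ i, 0 < w i (y i) := fun i =>
    lt_of_le_of_ne (hw0 _ _) (Ne.symm (Finset.prod_ne_zero_iff.mp hz i (Finset.mem_univ i)))
  have hqpos : ∀ i, 0 < q i (y i) := fun i =>
    lt_of_le_of_ne (hq0 _ _) (Ne.symm (hac i _ (hpos i).ne'))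
  set l := ∑ i : Fin N, (if (i : ℕ) < τ y then (1 : ℝ) else 0) *
    Real.log (w i (y i) / q i (y i)) with hl
  set f := Real.log M * (if p (τ y) y then (1 : ℝ) else 0) with hf
  -- Change of measure: the likelihood ratio of the observed outputs turns `w` into the law that
  -- follows `q` up to `τ` and `w` afterwards.
  have hexpl : (∏ i, w i (y i)) * Real.exp (-l) =
      ∏ i : Fin N, if (i : ℕ) < τ y then q i (y i) else w i (y i) := by
    rw [hl, ← Finset.sum_neg_distrib, Real.exp_sum, ← Finset.prod_mul_distrib]
    refine Finset.prod_congr rfl fun i _ => ?_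
    split_ifs with h
    · rw [one_mul, ← Real.log_inv, inv_div, Real.exp_log (div_pos (hqpos i) (hpos i))]
      field_simp [(hpos i).ne']
    · simp
  have hexpf : Real.exp f = 1 + (M - 1) * (if p (τ y) y then (1 : ℝ) else 0) := by
    rw [hf]
    split_ifs
    · rw [mul_one, Real.exp_log (by linarith)]; ring
    · simp
  -- This is x + 1 ≤ e^x at x = f - l - ln 2. The shift ln 2 suits the average over messages, in
  -- which the mean of e^{f-l} is at most 1 + (M-1)/M < 2.
  have hkey : f - l ≤ Real.log 2 - 1 + Real.exp f * Real.exp (-l) / 2 := by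
    have := Real.add_one_le_exp (f - l - Real.log 2)
    rw [Real.exp_sub, Real.exp_log (by norm_num), sub_eq_add_neg f l, Real.exp_add] at this
    linarith
  have := mul_le_mul_of_nonneg_left hkey (Finset.prod_nonneg fun i _ => hw0 i (y i) :
    0 ≤ ∏ i, w i (y i))
  rw [← hexpl, ← hexpf]
  calc _ = (∏ i, w i (y i)) * (f - l) := by rw [hf]; ring
    _ ≤ _ := this
    _ = _ := by ring

/-- Fano's inequality for a decoder that stops at time `τ`: the information about a uniform message
is at most the sum of the mutual informations of the coordinates observed before `τ`. -/
theorem log_card_mul_avg_prob_le {τ : (Fin N → Y) → ℕ} (hτ : IsStopping τ) {M : ℕ} (hM : 1 ≤ M)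
    (dec : ℕ → (Fin N → Y) → Fin M)
    (hdec : ∀ s y y', (∀ i : Fin N, (i : ℕ) < s → y' i = y i) → dec s y' = dec s y)
    (w : Fin M → Fin N → Y → ℝ) (hw0 : ∀ m i v, 0 ≤ w m i v) (hw : ∀ m i, ∑ v, w m i v = 1) :
    Real.log M * ((1 / (M : ℝ)) * ∑ m, ∑ y, (∏ i, w m i (y i)) *
        (if dec (τ y) y = m then (1 : ℝ) else 0)) ≤
      Real.log 2 + (1 / (M : ℝ)) * ∑ m, ∑ i : Fin N,
        (∑ y, (∏ j, w m j (y j)) * (if (i : ℕ) < τ y then (1 : ℝ) else 0)) *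
        ∑ v, w m i v * Real.log (w m i v / ((1 / (M : ℝ)) * ∑ m', w m' i v)) := by
  classical
  have hM0 : (0 : ℝ) < M := by exact_mod_cast hM
  set q : Fin N → Y → ℝ := fun i v => (1 / (M : ℝ)) * ∑ m', w m' i v with hqdef
  have hq0 : ∀ i v, 0 ≤ q i v := fun i v =>
    mul_nonneg (by positivity) (Finset.sum_nonneg fun m _ => hw0 m i v)
  have hq : ∀ i, ∑ v, q i v = 1 := fun i => by
    simp only [hqdef, ← Finset.mul_sum]
    rw [Finset.sum_comm, Finset.sum_congr rfl fun m _ => hw m i]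
    simp [hM0.ne']
  have hac : ∀ m i v, w m i v ≠ 0 → q i v ≠ 0 := fun m i v h => by
    have : 0 < ∑ m', w m' i v := Finset.sum_pos' (fun m' _ => hw0 m' i v)
      ⟨m, Finset.mem_univ m, lt_of_le_of_ne (hw0 m i v) (Ne.symm h)⟩
    simp only [hqdef]; positivity
  have hsum := Finset.sum_le_sum fun m (_ : m ∈ (Finset.univ : Finset (Fin M))) =>
    log_mul_prob_sub_divergence_le hτ (fun s y => dec s y = m)
      (fun s y y' h => by rw [hdec s y y' h]) (w m) q (hw0 m) hq0 (hw m) hq (hac m)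
      (M := M) (by exact_mod_cast hM)
  rw [Finset.sum_sub_distrib, ← Finset.mul_sum, Finset.sum_add_distrib, ← Finset.mul_sum] at hsum
  -- The reference law is common to all messages, and the decoding events partition the output
  -- space.
  have htot : ∑ m : Fin M, ∑ y, (∏ i, q i (y i)) *
      (if dec (τ y) y = m then (1 : ℝ) else 0) = 1 := by
    rw [Finset.sum_comm]
    refine (Finset.sum_congr rfl fun y _ => ?_).trans (sum_prod_eq_one q hq)
    rw [← Finset.mul_sum, Finset.sum_ite_eq]; simp
  rw [htot] at hsum
  simp only [Finset.sum_const, Finset.card_univ, Fintype.card_fin, nsmul_eq_mul] at hsum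
  have h2 := mul_le_mul_of_nonneg_left hsum (by positivity : (0 : ℝ) ≤ 1 / M)
  have h3 : 1 / (M : ℝ) * (M * (Real.log 2 - 1 / 2) + (M - 1) / 2 * 1) ≤ Real.log 2 := by
    have : 1 / (M : ℝ) * (M * (Real.log 2 - 1 / 2) + (M - 1) / 2 * 1) =
      Real.log 2 - 1 / (2 * M) := by field_simp; ring
    rw [this]
    have : (0 : ℝ) < 1 / (2 * M) := by positivity
    linarith
  linarith [h2, h3]

end Converse

theorem sum_toReal_pmf {Y : Type*} [Fintype Y] (p : PMF Y) : ∑ v, (p v).toReal = 1 := by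
  have h : ∑ v, p v = 1 := by rw [← tsum_fintype (L := .unconditional Y), p.tsum_coe]
  rw [← ENNReal.toReal_sum fun v _ => p.apply_ne_top v, h, ENNReal.toReal_one]

/-! ### Mutual information for an empirical input distribution -/

theorem sum_toReal_map_mul {X : Type*} [Fintype X] {ι : Type*} [Fintype ι] (p : PMF ι) (f : ι → X)
    (g : X → ℝ) : ∑ x, (p.map f x).toReal * g x = ∑ m, (p m).toReal * g (f m) := by
  classical
  have h : ∀ x, (p.map f x).toReal = ∑ m, if x = f m then (p m).toReal else 0 := fun x => by
    rw [PMF.map_apply, tsum_fintype, ENNReal.toReal_sum fun m _ => by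
      split_ifs; exacts [p.apply_ne_top m, ENNReal.zero_ne_top]]
    refine Finset.sum_congr rfl fun m _ => ?_
    by_cases hx : x = f m <;> simp [hx]
  simp_rw [h, Finset.sum_mul]
  rw [Finset.sum_comm]
  refine Finset.sum_congr rfl fun m _ => ?_
  simp [ite_mul]

/-- The information of a uniform message at one coordinate is the mutual information for the
empirical distribution of the input symbols there; this makes the capacity bound available. -/
theorem mutualInfo_map_uniform {X Y : Type*} [Fintype X] [Fintype Y] (Q : X → PMF Y) {M : ℕ}
    [Nonempty (Fin M)] (f : Fin M → X) :
    mutualInfo Q ((PMF.uniformOfFintype (Fin M)).map f) =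
      (1 / (M : ℝ)) * ∑ m, ∑ y, (Q (f m) y).toReal *
        Real.log ((Q (f m) y).toReal / ((1 / (M : ℝ)) * ∑ m', (Q (f m') y).toReal)) := by
  have hq : ∀ y, (((PMF.uniformOfFintype (Fin M)).map f).bind Q y).toReal =
      (1 / (M : ℝ)) * ∑ m', (Q (f m') y).toReal := fun y => by
    rw [PMF.bind_map, PMF.bind_apply, tsum_fintype, ENNReal.toReal_sum fun m _ =>
      ENNReal.mul_ne_top (PMF.apply_ne_top _ _) (PMF.apply_ne_top _ _), Finset.mul_sum]
    refine Finset.sum_congr rfl fun m _ => ?_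
    rw [ENNReal.toReal_mul]; simp
  unfold mutualInfo
  rw [sum_toReal_map_mul, Finset.mul_sum]
  refine Finset.sum_congr rfl fun m _ => ?_
  simp only [hq]
  simp

theorem mutualInfo_le_capacity {X Y : Type*} [Fintype X] [Fintype Y] {Q : X → PMF Y}
    (hC : 0 < capacity Q) (P : PMF X) : mutualInfo Q P ≤ capacity Q := by
  refine le_ciSup (f := fun P : PMF X => mutualInfo Q P) ?_ P
  -- A real supremum over an unbounded family is 0 by convention, so a positive capacity certifies
  -- boundedness.
  by_contra h
  exact hC.ne' (Real.iSup_of_not_bddAbove h)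

/-! ### Expectations under a code, and the cost of stopping inside the preamble -/

namespace Code

section

variable {X Y : Type*} {n : ℕ} (c : Code X Y n)

theorem M_pos : 0 < c.M := lt_of_lt_of_le two_pos c.two_le_M

theorem isStopping_τ (u : Fin c.K) : IsStopping (c.τ u) := c.τ_stopping u

variable {c} in
theorem HasCommonPreamble.input_eq {k : ℕ} (h : c.HasCommonPreamble k) (star : X) (m m' : Fin c.M)
    {t : ℕ} {i : Fin (c.A + n - 1)} (hi : (i : ℕ) + 1 < t + k) :
    c.input star m t i = c.input star m' t i := by
  unfold input
  split_ifs with h1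
  · exact h m m' _ (by simp only; omega)
  · rfl

theorem input_eq_star_of_lt (star : X) (m : Fin c.M) {t : ℕ} {i : Fin (c.A + n - 1)}
    (hi : (i : ℕ) + 1 < t) : c.input star m t i = star := by
  unfold input
  rw [dif_neg (by omega)]

theorem input_eq_star_of_le (star : X) (m : Fin c.M) {t : ℕ} {i : Fin (c.A + n - 1)}
    (hi : t + n ≤ (i : ℕ) + 1) : c.input star m t i = star := by
  unfold input
  rw [dif_neg (by omega)]

variable {c} in
/-- A sliding-window rule has not stopped before `s` depends only on the outputs that enter the
windows of the times before `s`. -/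
theorem HasWindowStopping.le_τ_iff {k : ℕ} (h : c.HasWindowStopping k) (u : Fin c.K)
    (y y' : Fin (c.A + n - 1) → Y) (s : ℕ)
    (hy : ∀ i : Fin (c.A + n - 1), (i : ℕ) + n + 1 < s + k → y i = y' i) :
    s ≤ c.τ u y ↔ s ≤ c.τ u y' := by
  induction s with
  | zero => simp
  | succ s ih =>
    have ih' := ih fun i hi => hy i (by omega)
    by_cases hs : s ≤ c.τ u y
    · have hs' := ih'.1 hs
      have := h u s y y' (fun i _ hi => hy i (by omega)) hs hs'
      omega
    · have hs' := fun h' => hs (ih'.2 h')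
      omega

end

section Expectation

variable {X Y : Type*} [Fintype Y] {n : ℕ} (c : Code X Y n) (Q : X → PMF Y) (star : X)

theorem expect_mono (m : Fin c.M) (t : ℕ) {f g : Fin c.K → (Fin (c.A + n - 1) → Y) → ℝ}
    (h : ∀ u y, f u y ≤ g u y) : c.expect Q star m t f ≤ c.expect Q star m t g := by
  unfold expect
  gcongr with u _ y _
  exact h u y

theorem expect_nonneg (m : Fin c.M) (t : ℕ) {f : Fin c.K → (Fin (c.A + n - 1) → Y) → ℝ}
    (h : ∀ u y, 0 ≤ f u y) : 0 ≤ c.expect Q star m t f := by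
  have := c.expect_mono Q star m t (f := fun _ _ => 0) (g := f) h
  simpa [expect] using this

theorem expect_add (m : Fin c.M) (t : ℕ) (f g : Fin c.K → (Fin (c.A + n - 1) → Y) → ℝ) :
    c.expect Q star m t (fun u y => f u y + g u y) =
      c.expect Q star m t f + c.expect Q star m t g := by
  simp only [expect, mul_add, Finset.sum_add_distrib]

theorem expect_sub (m : Fin c.M) (t : ℕ) (f g : Fin c.K → (Fin (c.A + n - 1) → Y) → ℝ) :
    c.expect Q star m t (fun u y => f u y - g u y) =
      c.expect Q star m t f - c.expect Q star m t g := by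
  simp only [expect, mul_sub, Finset.sum_sub_distrib]

theorem expect_const_mul (m : Fin c.M) (t : ℕ) (a : ℝ)
    (f : Fin c.K → (Fin (c.A + n - 1) → Y) → ℝ) :
    c.expect Q star m t (fun u y => a * f u y) = a * c.expect Q star m t f := by
  simp only [expect, Finset.mul_sum]
  refine Finset.sum_congr rfl fun u _ => Finset.sum_congr rfl fun y _ => by ring

theorem expect_finset_sum {κ : Type*} (s : Finset κ) (m : Fin c.M) (t : ℕ)
    (f : κ → Fin c.K → (Fin (c.A + n - 1) → Y) → ℝ) :
    c.expect Q star m t (fun u y => ∑ j ∈ s, f j u y) =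
      ∑ j ∈ s, c.expect Q star m t (f j) := by
  simp only [expect, Finset.mul_sum]
  refine (Finset.sum_congr rfl fun u _ => Finset.sum_comm).trans ?_
  rw [Finset.sum_comm]

theorem expect_const (m : Fin c.M) (t : ℕ) (a : ℝ) :
    c.expect Q star m t (fun _ _ => a) = a := by
  simp only [expect, ← Finset.sum_mul]
  rw [sum_prod_eq_one _ fun i => sum_toReal_pmf _, one_mul, sum_toReal_pmf, one_mul]

variable {c} in
theorem expect_congr_input {m m' : Fin c.M} {t t' : ℕ}
    {f : Fin c.K → (Fin (c.A + n - 1) → Y) → ℝ} (S : Set (Fin (c.A + n - 1)))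
    (hf : ∀ u, DependsOn (f u) S)
    (h : ∀ i ∈ S, c.input star m t i = c.input star m' t' i) :
    c.expect Q star m t f = c.expect Q star m' t' f := by
  unfold expect
  refine Finset.sum_congr rfl fun u _ => ?_
  congr 1
  exact sum_prod_mul_congr S (fun i v => (Q (c.input star m' t' i) v).toReal)
    (fun i v => (Q (c.input star m t i) v).toReal) (f u) (hf u) (fun i => sum_toReal_pmf _)
    (fun i => sum_toReal_pmf _) fun i hi => by rw [h i hi]

open Classical in
/-- The error probability at a given start time, averaged over the messages. -/
def avgError (t : ℕ) : ℝ :=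
  (1 / (c.M : ℝ)) * ∑ m, c.expect Q star m t (fun u y => if c.φ (c.τ u y) y ≠ m then 1 else 0)

theorem avg_avgError_le :
    (1 / (c.A : ℝ)) * ∑ t ∈ Finset.Icc 1 c.A, c.avgError Q star t ≤ c.errorProb Q star := by
  classical
  have hM : (0 : ℝ) < c.M := by exact_mod_cast c.M_pos
  unfold avgError errorProb
  rw [← Finset.mul_sum, Finset.sum_comm, mul_left_comm, Finset.mul_sum]
  calc _ ≤ 1 / (c.M : ℝ) * ∑ m : Fin c.M, c.errorProb Q star := by
        gcongr with m
        exact le_ciSup (f := fun m : Fin c.M => (1 / (c.A : ℝ)) * ∑ t ∈ Finset.Icc 1 c.A,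
          c.expect Q star m t (fun u y => if c.φ (c.τ u y) y ≠ m then 1 else 0))
          (Set.finite_range _).bddAbove m
    _ = _ := by simp [hM.ne', errorProb]

theorem avg_expect_le_delay (m : Fin c.M) :
    (1 / (c.A : ℝ)) * ∑ t ∈ Finset.Icc 1 c.A,
      c.expect Q star m t (fun u y => max 0 ((c.τ u y : ℝ) - (t : ℝ))) ≤ c.delay Q star :=
  le_ciSup (f := fun m : Fin c.M => (1 / (c.A : ℝ)) * ∑ t ∈ Finset.Icc 1 c.A,
    c.expect Q star m t (fun u y => max 0 ((c.τ u y : ℝ) - (t : ℝ))))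
    (Set.finite_range _).bddAbove m

theorem sum_avgError_le :
    ∑ t ∈ Finset.Icc 1 c.A, c.avgError Q star t ≤ c.A * c.errorProb Q star := by
  have hA : (0 : ℝ) < c.A := by exact_mod_cast c.one_le_A
  have := c.avg_avgError_le Q star
  rwa [one_div, inv_mul_le_iff₀ hA] at this

theorem sum_expect_le (m : Fin c.M) :
    ∑ t ∈ Finset.Icc 1 c.A,
      c.expect Q star m t (fun u y => max 0 ((c.τ u y : ℝ) - (t : ℝ))) ≤
        c.A * c.delay Q star := by
  have hA : (0 : ℝ) < c.A := by exact_mod_cast c.one_le_A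
  have := c.avg_expect_le_delay Q star m
  rwa [one_div, inv_mul_le_iff₀ hA] at this

theorem delay_nonneg : 0 ≤ c.delay Q star := by
  refine le_trans ?_ (c.avg_expect_le_delay Q star ⟨0, c.M_pos⟩)
  exact mul_nonneg (by positivity) (Finset.sum_nonneg fun t _ =>
    c.expect_nonneg Q star _ t fun u y => le_max_left _ _)

variable {c}

open Classical in
/-- Stopping before the end of the common preamble leaves nothing but a guess of the message. -/
theorem HasCommonPreamble.expect_stop_le {k : ℕ} (h : c.HasCommonPreamble k) (m₀ : Fin c.M)
    (t : ℕ) :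
    c.expect Q star m₀ t (fun u y => if c.τ u y < t + k then 1 else 0) ≤
      2 * c.avgError Q star t := by
  have hM : (2 : ℝ) ≤ c.M := by exact_mod_cast c.two_le_M
  set F : Fin c.K → (Fin (c.A + n - 1) → Y) → ℝ :=
    fun u y => if c.τ u y < t + k then 1 else 0 with hF
  set G : Fin c.M → Fin c.K → (Fin (c.A + n - 1) → Y) → ℝ :=
    fun m u y => if c.τ u y < t + k ∧ c.φ (c.τ u y) y ≠ m then 1 else 0 with hG
  -- Stopping before `t + k` with a wrong decision is determined by the outputs before `t + k`,
  -- whose law is the same for all messages.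
  have hdep : ∀ m u, DependsOn (G m u) {i | (i : ℕ) + 1 < t + k} := by
    intro m u y y' hy
    have key : ∀ z z' : Fin (c.A + n - 1) → Y, (∀ i ∈
        {i : Fin (c.A + n - 1) | (i : ℕ) + 1 < t + k}, z i = z' i) →
        c.τ u z < t + k ∧ c.φ (c.τ u z) z ≠ m →
        c.τ u z' < t + k ∧ c.φ (c.τ u z') z' ≠ m := by
      rintro z z' hz ⟨h1, h2⟩
      have hz' : ∀ i : Fin (c.A + n - 1), (i : ℕ) < c.τ u z → z' i = z i := fun i hi =>
        (hz i (by simp only [Set.mem_ofPred_eq]; omega)).symm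
      rw [c.τ_stopping u z z' hz', c.φ_adapted _ z z' hz']
      exact ⟨h1, h2⟩
    have : (c.τ u y < t + k ∧ c.φ (c.τ u y) y ≠ m) ↔
        (c.τ u y' < t + k ∧ c.φ (c.τ u y') y' ≠ m) :=
      ⟨key y y' hy, key y' y fun i hi => (hy i hi).symm⟩
    simp only [hG, this]
  -- Whatever message is declared, exactly M - 1 messages are wronged.
  have hsum : ∀ u y, ∑ m, G m u y = (c.M - 1) * F u y := by
    intro u y
    simp only [hG, hF]
    by_cases h1 : c.τ u y < t + k
    · simp only [h1, true_and, if_true]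
      rw [Finset.sum_congr rfl (g := fun m => 1 - if c.φ (c.τ u y) y = m then (1 : ℝ) else 0)
        fun m _ => by by_cases h2 : c.φ (c.τ u y) y = m <;> simp [h2], Finset.sum_sub_distrib,
        Finset.sum_ite_eq]
      simp
    · simp [h1]
  have h1 : ((c.M : ℝ) - 1) * c.expect Q star m₀ t F ≤ c.M * c.avgError Q star t := by
    unfold avgError
    rw [← mul_assoc, mul_one_div_cancel (by linarith), one_mul, ← expect_const_mul]
    simp_rw [← hsum]
    rw [expect_finset_sum]
    refine Finset.sum_le_sum fun m _ => ?_
    rw [expect_congr_input Q star _ (hdep m)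
      (fun i hi => h.input_eq star m₀ m (t := t) hi)]
    refine c.expect_mono Q star m t fun u y => ?_
    simp only [hG]
    by_cases h2 : c.φ (c.τ u y) y = m <;> simp [h2]
    split_ifs <;> norm_num
  have h0 : 0 ≤ c.expect Q star m₀ t F :=
    c.expect_nonneg Q star _ t fun u y => by simp only [hF]; split_ifs <;> norm_num
  -- M ≥ 2 gives M/(M-1) ≤ 2.
  nlinarith

/-- The delay is at least about the length of the common preamble. -/
theorem HasCommonPreamble.mul_le_delay {k : ℕ} (h : c.HasCommonPreamble k) :
    (k : ℝ) * (1 - 2 * c.errorProb Q star) ≤ c.delay Q star := by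
  classical
  have hA : (0 : ℝ) < c.A := by exact_mod_cast c.one_le_A
  set m₀ : Fin c.M := ⟨0, c.M_pos⟩
  have h1 : ∀ t, (k : ℝ) * (1 - 2 * c.avgError Q star t) ≤
      c.expect Q star m₀ t (fun u y => max 0 ((c.τ u y : ℝ) - (t : ℝ))) := by
    intro t
    have h2 := h.expect_stop_le Q star m₀ t
    have h3 : c.expect Q star m₀ t
        (fun u y => (k : ℝ) * (1 - if c.τ u y < t + k then 1 else 0)) ≤
        c.expect Q star m₀ t (fun u y => max 0 ((c.τ u y : ℝ) - (t : ℝ))) := by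
      refine c.expect_mono Q star m₀ t fun u y => ?_
      split_ifs with h4
      · simp
      · refine le_trans ?_ (le_max_right _ _)
        have : ((t + k : ℕ) : ℝ) ≤ c.τ u y := by exact_mod_cast not_lt.mp h4
        push_cast at this
        linarith
    rw [expect_const_mul, expect_sub, expect_const] at h3
    refine le_trans ?_ h3
    have : (0 : ℝ) ≤ k := by positivity
    nlinarith
  have h2 := (Finset.sum_le_sum fun t (_ : t ∈ Finset.Icc 1 c.A) => h1 t).trans
    (c.sum_expect_le Q star m₀)
  rw [← Finset.mul_sum, Finset.sum_sub_distrib, ← Finset.mul_sum] at h2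
  simp only [Finset.sum_const, Nat.card_Icc, add_tsub_cancel_right, nsmul_eq_mul, mul_one] at h2
  have h3 := c.sum_avgError_le Q star
  have h4 : (0 : ℝ) ≤ k := by positivity
  have h5 : (c.A : ℝ) * (k * (1 - 2 * c.errorProb Q star)) ≤ c.A * c.delay Q star := by
    nlinarith [mul_le_mul_of_nonneg_left h3 h4]
  exact le_of_mul_le_mul_left h5 hA

end Expectation

end Code

/-! ### The rate bound: information in the outputs that follow the preamble -/

namespace Code

section Rate

variable {X Y : Type*} [Fintype Y] {n : ℕ} {c : Code X Y n} {Q : X → PMF Y} {star : X}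

/-- The per-coordinate information of a uniform message is at most the capacity, and it vanishes
where all messages have the same input. -/
theorem avg_divergence_le_capacity [Fintype X] (hC : 0 < capacity Q) (t : ℕ)
    (i : Fin (c.A + n - 1)) :
    (1 / (c.M : ℝ)) * ∑ m, ∑ v, (Q (c.input star m t i) v).toReal *
      Real.log ((Q (c.input star m t i) v).toReal /
        ((1 / (c.M : ℝ)) * ∑ m', (Q (c.input star m' t i) v).toReal)) ≤ capacity Q := by
  have : Nonempty (Fin c.M) := ⟨⟨0, c.M_pos⟩⟩
  rw [← mutualInfo_map_uniform Q fun m => c.input star m t i]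
  exact mutualInfo_le_capacity hC _

theorem divergence_eq_zero_of_input_eq {t : ℕ} {i : Fin (c.A + n - 1)}
    (h : ∀ m m', c.input star m t i = c.input star m' t i) (m : Fin c.M) :
    ∑ v, (Q (c.input star m t i) v).toReal *
      Real.log ((Q (c.input star m t i) v).toReal /
        ((1 / (c.M : ℝ)) * ∑ m', (Q (c.input star m' t i) v).toReal)) = 0 := by
  have hM : (c.M : ℝ) ≠ 0 := by exact_mod_cast c.M_pos.ne'
  refine Finset.sum_eq_zero fun v _ => ?_
  rw [Finset.sum_congr rfl fun m' _ => by rw [h m' m]]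
  simp only [Finset.sum_const, Finset.card_univ, Fintype.card_fin, nsmul_eq_mul]
  rw [← mul_assoc, one_div_mul_cancel hM, one_mul]
  by_cases h0 : (Q (c.input star m t i) v).toReal = 0
  · simp [h0]
  · rw [div_self h0]; simp

open Classical in
/-- For a training-based code, and at a fixed start time, the information about the message is at
most the capacity times the mean number of observed outputs that carry information. -/
theorem one_sub_avgError_mul_log_le [Fintype X] (hC : 0 < capacity Q) {k : ℕ}
    (hpre : c.HasCommonPreamble k) (hwin : c.HasWindowStopping k) (m₀ : Fin c.M) (t : ℕ) {a b : ℝ}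
    (hab : ∀ s : ℕ, ((Finset.univ.filter fun i : Fin (c.A + n - 1) =>
      t + k ≤ (i : ℕ) + 1 ∧ (i : ℕ) + 1 < t + n ∧ (i : ℕ) < s).card : ℝ) ≤
        a * max 0 ((s : ℝ) - t) + b) :
    (1 - c.avgError Q star t) * Real.log c.M ≤ Real.log 2 + capacity Q *
      (a * c.expect Q star m₀ t (fun u y => max 0 ((c.τ u y : ℝ) - (t : ℝ))) + b) := by
  have hM : (0 : ℝ) < c.M := by exact_mod_cast c.M_pos
  set D : Fin c.M → Fin (c.A + n - 1) → ℝ := fun m i =>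
    ∑ v, (Q (c.input star m t i) v).toReal *
      Real.log ((Q (c.input star m t i) v).toReal /
        ((1 / (c.M : ℝ)) * ∑ m', (Q (c.input star m' t i) v).toReal)) with hD
  set p : Fin c.K → Fin c.M → Fin (c.A + n - 1) → ℝ := fun u m i =>
    ∑ y : Fin (c.A + n - 1) → Y, (∏ j, (Q (c.input star m t j) (y j)).toReal) *
      (if (i : ℕ) < c.τ u y then (1 : ℝ) else 0) with hp
  have hp0 : ∀ u m i, 0 ≤ p u m i := fun u m i => Finset.sum_nonneg fun y _ =>
    mul_nonneg (Finset.prod_nonneg fun j _ => ENNReal.toReal_nonneg) (by split_ifs <;> norm_num)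
  -- The event `i < τ` involves the windows of the times up to `i`, which end at Y_{i-n+k} at the
  -- latest. Since i + 1 < t + n, these outputs precede the message part, so the message does not
  -- affect their law.
  have hpm : ∀ u m (i : Fin (c.A + n - 1)), t + k ≤ (i : ℕ) + 1 ∧ (i : ℕ) + 1 < t + n →
      p u m i = p u m₀ i := by
    intro u m i hi
    refine sum_prod_mul_congr {j : Fin (c.A + n - 1) | (j : ℕ) + 1 < t + k}
      (fun j v => (Q (c.input star m₀ t j) v).toReal)
      (fun j v => (Q (c.input star m t j) v).toReal) _ ?_ (fun i => sum_toReal_pmf _)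
      (fun i => sum_toReal_pmf _) fun j hj => by rw [hpre.input_eq star m m₀ hj]
    intro y y' hy
    have := hwin.le_τ_iff u y y' (i + 1) fun j hj => hy j (by
      simp only [Set.mem_ofPred_eq]; omega)
    simp only [← Nat.succ_le_iff, Nat.succ_eq_add_one, this]
  have hcoord : ∀ u i, (1 / (c.M : ℝ)) * ∑ m, p u m i * D m i ≤
      capacity Q * (if t + k ≤ (i : ℕ) + 1 ∧ (i : ℕ) + 1 < t + n then p u m₀ i else 0) := by
    intro u i
    split_ifs with hi
    · have h1 : ∑ m, p u m i * D m i = p u m₀ i * ∑ m, D m i := by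
        rw [Finset.mul_sum]
        exact Finset.sum_congr rfl fun m _ => by rw [hpm u m i hi]
      rw [h1, mul_left_comm, mul_comm (capacity Q)]
      exact mul_le_mul_of_nonneg_left (avg_divergence_le_capacity hC t i) (hp0 u m₀ i)
    · have hin : ∀ m m', c.input star m t i = c.input star m' t i := by
        intro m m'
        by_cases h1 : (i : ℕ) + 1 < t + k
        · exact hpre.input_eq star m m' h1
        · have h2 : t + n ≤ (i : ℕ) + 1 := by
            by_contra h3; exact hi ⟨not_lt.mp h1, not_le.mp h3⟩
          rw [c.input_eq_star_of_le star m h2, c.input_eq_star_of_le star m' h2]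
      rw [Finset.sum_eq_zero fun m _ => by
        rw [show D m i = 0 from divergence_eq_zero_of_input_eq hin m, mul_zero]]
      simp
  have hseed : ∀ u, Real.log c.M * ((1 / (c.M : ℝ)) * ∑ m, ∑ y : Fin (c.A + n - 1) → Y,
      (∏ i, (Q (c.input star m t i) (y i)).toReal) *
        (if c.φ (c.τ u y) y = m then (1 : ℝ) else 0)) ≤ Real.log 2 + capacity Q *
      ∑ y : Fin (c.A + n - 1) → Y, (∏ i, (Q (c.input star m₀ t i) (y i)).toReal) *
        (a * max 0 ((c.τ u y : ℝ) - (t : ℝ)) + b) := by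
    intro u
    have h1 := log_card_mul_avg_prob_le (c.isStopping_τ u) c.M_pos c.φ
      (fun s y y' h => c.φ_adapted s y y' h)
      (fun m i v => (Q (c.input star m t i) v).toReal) (fun _ _ _ => ENNReal.toReal_nonneg)
      (fun _ _ => sum_toReal_pmf _)
    refine h1.trans (add_le_add le_rfl ?_)
    rw [Finset.sum_comm, Finset.mul_sum]
    refine (Finset.sum_le_sum fun i _ => hcoord u i).trans ?_
    rw [← Finset.mul_sum]
    refine mul_le_mul_of_nonneg_left ?_ hC.le
    simp only [hp]
    rw [← Finset.sum_filter, Finset.sum_comm]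
    refine Finset.sum_le_sum fun y _ => ?_
    rw [← Finset.mul_sum]
    refine mul_le_mul_of_nonneg_left ?_ (Finset.prod_nonneg fun j _ => ENNReal.toReal_nonneg)
    refine le_trans (le_of_eq ?_) (hab (c.τ u y))
    rw [← Finset.sum_filter, Finset.filter_filter]
    simp [and_assoc]
  have hsum := Finset.sum_le_sum fun u (_ : u ∈ (Finset.univ : Finset (Fin c.K))) =>
    mul_le_mul_of_nonneg_left (hseed u) (ENNReal.toReal_nonneg : 0 ≤ (c.seedLaw u).toReal)
  have hlhs : ∑ u, (c.seedLaw u).toReal * (Real.log c.M * ((1 / (c.M : ℝ)) * ∑ m,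
      ∑ y : Fin (c.A + n - 1) → Y, (∏ i, (Q (c.input star m t i) (y i)).toReal) *
        (if c.φ (c.τ u y) y = m then (1 : ℝ) else 0))) =
      (1 - c.avgError Q star t) * Real.log c.M := by
    have h1 : (1 / (c.M : ℝ)) * ∑ m, c.expect Q star m t
        (fun u y => if c.φ (c.τ u y) y = m then (1 : ℝ) else 0) = 1 - c.avgError Q star t := by
      unfold avgError
      have : ∀ m : Fin c.M, c.expect Q star m t
        (fun u y => if c.φ (c.τ u y) y = m then (1 : ℝ) else 0) = 1 - c.expect Q star m t
          (fun u y => if c.φ (c.τ u y) y ≠ m then (1 : ℝ) else 0) := by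
        intro m
        refine Eq.trans ?_ (congrArg (· - _) (c.expect_const Q star m t 1))
        rw [← expect_sub]
        congr 1
        ext u y
        by_cases h : c.φ (c.τ u y) y = m <;> simp [h]
      simp_rw [this]
      rw [Finset.sum_sub_distrib, mul_sub]
      simp [hM.ne']
    rw [← h1]
    simp only [expect]
    rw [Finset.sum_comm]
    simp only [Finset.mul_sum, Finset.sum_mul]
    exact Finset.sum_congr rfl fun u _ => Finset.sum_congr rfl fun m _ =>
      Finset.sum_congr rfl fun y _ => by ring
  have hrhs : ∑ u, (c.seedLaw u).toReal * (Real.log 2 + capacity Q *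
      ∑ y : Fin (c.A + n - 1) → Y, (∏ i, (Q (c.input star m₀ t i) (y i)).toReal) *
        (a * max 0 ((c.τ u y : ℝ) - (t : ℝ)) + b)) = Real.log 2 + capacity Q *
      (a * c.expect Q star m₀ t (fun u y => max 0 ((c.τ u y : ℝ) - (t : ℝ))) + b) := by
    have h1 : a * c.expect Q star m₀ t (fun u y => max 0 ((c.τ u y : ℝ) - (t : ℝ))) + b =
        c.expect Q star m₀ t (fun u y => a * max 0 ((c.τ u y : ℝ) - (t : ℝ)) + b) := by
      rw [expect_add, expect_const_mul, expect_const]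
    rw [h1, expect, Finset.mul_sum]
    simp_rw [mul_add (ENNReal.toReal _) (Real.log 2)]
    rw [Finset.sum_add_distrib, ← Finset.sum_mul, sum_toReal_pmf, one_mul]
    congr 1
    exact Finset.sum_congr rfl fun u _ => mul_left_comm _ _ _
  rw [hlhs, hrhs] at hsum
  exact hsum

/-- The number of observed message symbols enters through an affine bound in the delay, because such
a bound passes through the averages over outputs and start times. It is used with `a = 0`, `b = n`
and with `a = 1 - η`, `b = 2`. -/
theorem one_sub_errorProb_mul_log_le [Fintype X] (hC : 0 < capacity Q) {k : ℕ}
    (hpre : c.HasCommonPreamble k) (hwin : c.HasWindowStopping k) {a b : ℝ} (ha : 0 ≤ a)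
    (hab : ∀ s t : ℕ, ((Finset.univ.filter fun i : Fin (c.A + n - 1) =>
      t + k ≤ (i : ℕ) + 1 ∧ (i : ℕ) + 1 < t + n ∧ (i : ℕ) < s).card : ℝ) ≤
        a * max 0 ((s : ℝ) - t) + b) :
    (1 - c.errorProb Q star) * Real.log c.M ≤
      Real.log 2 + capacity Q * (a * c.delay Q star + b) := by
  have hA : (0 : ℝ) < c.A := by exact_mod_cast c.one_le_A
  set m₀ : Fin c.M := ⟨0, c.M_pos⟩
  have h1 := Finset.sum_le_sum fun t (_ : t ∈ Finset.Icc 1 c.A) =>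
    one_sub_avgError_mul_log_le (star := star) hC hpre hwin m₀ t fun s => hab s t
  rw [← Finset.sum_mul, Finset.sum_sub_distrib, Finset.sum_add_distrib, ← Finset.mul_sum,
    Finset.sum_add_distrib, ← Finset.mul_sum] at h1
  simp only [Finset.sum_const, Nat.card_Icc, add_tsub_cancel_right, nsmul_eq_mul, mul_one] at h1
  have h2 := c.sum_avgError_le Q star
  have h3 := mul_le_mul_of_nonneg_left
    (mul_le_mul_of_nonneg_left (c.sum_expect_le Q star m₀) ha) hC.le
  have h4 : 0 ≤ Real.log c.M := Real.log_nonneg (by exact_mod_cast c.M_pos)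
  have h5 := mul_le_mul_of_nonneg_right h2 h4
  refine le_of_mul_le_mul_left ?_ hA
  linarith

theorem card_info_le (N n k t s : ℕ) : (Finset.univ.filter fun i : Fin N =>
      t + k ≤ (i : ℕ) + 1 ∧ (i : ℕ) + 1 < t + n ∧ (i : ℕ) < s).card ≤
      min (t + n) (s + 1) - (t + k) := by
  rw [← Nat.card_Ico]
  refine Finset.card_le_card_of_injOn (fun i => (i : ℕ) + 1) (fun i hi => ?_)
    (fun i _ j _ h => Fin.ext (by simpa using h))
  simp only [Finset.coe_filter, Finset.mem_univ, true_and, Set.mem_ofPred_eq] at hi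
  simp only [Finset.coe_Ico, Set.mem_Ico]
  omega

/-- The number of codewords of a training-based code is at most exponential in the length. -/
theorem one_sub_errorProb_mul_log_le_length [Fintype X] (hC : 0 < capacity Q) {k : ℕ}
    (hpre : c.HasCommonPreamble k) (hwin : c.HasWindowStopping k) :
    (1 - c.errorProb Q star) * Real.log c.M ≤ Real.log 2 + capacity Q * n := by
  have := one_sub_errorProb_mul_log_le (star := star) hC hpre hwin (a := 0) (b := n) le_rfl
    fun s t => by
      rw [zero_mul, zero_add, Nat.cast_le]
      exact (card_info_le _ n k t s).trans (by omega)
  simpa using this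

/-- Only the fraction of the delay that follows the preamble carries information. -/
theorem one_sub_errorProb_mul_log_le_delay [Fintype X] (hC : 0 < capacity Q) {η : ℝ} (hη0 : 0 ≤ η)
    (hη1 : η ≤ 1) (hpre : c.HasCommonPreamble ⌊η * n⌋₊) (hwin : c.HasWindowStopping ⌊η * n⌋₊) :
    (1 - c.errorProb Q star) * Real.log c.M ≤
      Real.log 2 + capacity Q * ((1 - η) * c.delay Q star + 2) := by
  refine one_sub_errorProb_mul_log_le hC hpre hwin (by linarith) fun s t => ?_
  have h1 := card_info_le (c.A + n - 1) n ⌊η * n⌋₊ t s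
  have h2 : η * n < ⌊η * n⌋₊ + 1 := Nat.lt_floor_add_one _
  set k := ⌊η * n⌋₊
  have h3 := le_max_left 0 ((s : ℝ) - t)
  have h4 := le_max_right 0 ((s : ℝ) - t)
  set d := max 0 ((s : ℝ) - t)
  refine (Nat.cast_le.mpr h1).trans ?_
  rcases le_total (min (t + n) (s + 1)) (t + k) with h5 | h5
  · rw [Nat.sub_eq_zero_of_le h5]
    have := mul_nonneg (by linarith : 0 ≤ 1 - η) h3
    push_cast; linarith
  · have h6 := min_le_left (t + n) (s + 1)
    have h7 := min_le_right (t + n) (s + 1)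
    rw [Nat.cast_sub h5]
    have h6' : ((min (t + n) (s + 1) : ℕ) : ℝ) ≤ t + n := by exact_mod_cast h6
    have h7' : ((min (t + n) (s + 1) : ℕ) : ℝ) ≤ s + 1 := by exact_mod_cast h7
    set z := ((min (t + n) (s + 1) : ℕ) : ℝ)
    push_cast
    -- Convex combination of z ≤ t + n and z ≤ s + 1 with weights η and 1 - η. The constant 2
    -- absorbs the 1 in s + 1 and the loss from rounding ηn down.
    nlinarith [mul_le_mul_of_nonneg_left h6' hη0, mul_le_mul_of_nonneg_left h7'
      (by linarith : 0 ≤ 1 - η), mul_le_mul_of_nonneg_left h4 (by linarith : 0 ≤ 1 - η)]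

end Rate

end Code

/-! ### False alarms under pure noise limit the asynchronism level -/

namespace Code

section FalseAlarm

variable {X Y : Type*} [Fintype Y] {n : ℕ} {c : Code X Y n} {Q : X → PMF Y} {star : X}

variable (c Q star) in
/-- The probability, when nothing is sent, that the decoder with the seed `u` has not stopped
before the time `s`. -/
def noiseSurvival (u : Fin c.K) (s : ℕ) : ℝ :=
  ∑ y : Fin (c.A + n - 1) → Y, (∏ i, (Q star (y i)).toReal) *
    (if s ≤ c.τ u y then (1 : ℝ) else 0)

theorem noiseSurvival_nonneg (u : Fin c.K) (s : ℕ) : 0 ≤ c.noiseSurvival Q star u s :=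
  Finset.sum_nonneg fun y _ => mul_nonneg (Finset.prod_nonneg fun j _ => ENNReal.toReal_nonneg)
    (by split_ifs <;> norm_num)

/-- If the decoder can stop at the time `s = τ(y₀)`, then under pure noise it stops within
`(s - n, s]` with a probability at least that of the pattern of `y₀` in the window of `s`. -/
theorem HasWindowStopping.exp_mul_noiseSurvival_le {k : ℕ} (hwin : c.HasWindowStopping k)
    (hn : 1 ≤ n) {μ : ℝ} (hμ0 : 0 ≤ μ) (hμ : ∀ v, Real.exp (-μ) ≤ (Q star v).toReal)
    (u : Fin c.K) (y₀ : Fin (c.A + n - 1) → Y) :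
    Real.exp (-(μ * k)) * c.noiseSurvival Q star u (c.τ u y₀) ≤
      ∑ y : Fin (c.A + n - 1) → Y, (∏ i, (Q star (y i)).toReal) *
        (if c.τ u y ≤ c.τ u y₀ ∧ c.τ u y₀ < c.τ u y + n then (1 : ℝ) else 0) := by
  classical
  set s := c.τ u y₀ with hs
  set W : Finset (Fin (c.A + n - 1)) :=
    Finset.univ.filter fun i => s ≤ (i : ℕ) + n ∧ (i : ℕ) + n < s + k with hW
  -- Noise restricted to the pattern of `y₀` in the window of `s`: each coordinate in `W` keeps the
  -- mass of one symbol, at least e^{-μ}.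
  set w' : Fin (c.A + n - 1) → Y → ℝ := fun i v =>
    if i ∈ W ∧ v ≠ y₀ i then 0 else (Q star v).toReal with hw'
  have hcard : W.card ≤ k := by
    have : W.card ≤ (Finset.Ico s (s + k)).card :=
      Finset.card_le_card_of_injOn (fun i => (i : ℕ) + n) (fun i hi => by
        simp only [hW, Finset.coe_filter, Finset.mem_univ, true_and, Set.mem_ofPred_eq] at hi
        simpa using hi) (fun i _ j _ h => Fin.ext (by simpa using h))
    simpa using this
  have hprod : Real.exp (-(μ * k)) ≤ ∏ i ∈ W, ∑ v, w' i v := by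
    calc Real.exp (-(μ * k)) ≤ Real.exp (-μ) ^ W.card := by
          rw [← Real.exp_nat_mul]
          refine Real.exp_le_exp.mpr ?_
          have : (W.card : ℝ) ≤ k := by exact_mod_cast hcard
          nlinarith
      _ = ∏ i ∈ W, Real.exp (-μ) := by simp
      _ ≤ _ := by
          refine Finset.prod_le_prod (fun _ _ => (Real.exp_pos _).le) fun i hi => ?_
          refine (hμ (y₀ i)).trans ?_
          have h0 : ∀ v ∈ (Finset.univ : Finset Y), 0 ≤ w' i v := fun v _ => by
            simp only [hw']; split_ifs; exacts [le_rfl, ENNReal.toReal_nonneg]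
          refine le_trans (le_of_eq ?_) (Finset.single_le_sum h0 (Finset.mem_univ (y₀ i)))
          simp [hw']
  -- The window starts at Y_{s-n+1}, whereas a stop by time s - n is determined by earlier outputs.
  -- Hence the pattern and survival past s - n are independent.
  have hdep : DependsOn (fun y => if s < c.τ u y + n then (1 : ℝ) else 0) (↑W : Set _)ᶜ := by
    have key : ∀ z z' : Fin (c.A + n - 1) → Y, (∀ i ∈ (↑W : Set (Fin (c.A + n - 1)))ᶜ,
        z i = z' i) → c.τ u z + n ≤ s → c.τ u z' + n ≤ s := by
      intro z z' hz h1
      rwa [c.τ_stopping u z z' fun i hi => (hz i (by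
        simp only [hW, Finset.coe_filter, Finset.mem_univ, true_and, Set.mem_compl_iff,
          Set.mem_ofPred_eq]
        omega)).symm]
    intro y y' hy
    have : c.τ u y + n ≤ s ↔ c.τ u y' + n ≤ s :=
      ⟨key y y' hy, key y' y fun i hi => (hy i hi).symm⟩
    simp only [← not_le, this]
  have hfac := sum_prod_mul_eq_of_eq_off W (fun _ v => (Q star v).toReal) w' _ hdep
    (fun _ _ => sum_toReal_pmf _) (fun i hi => by ext v; simp [hw', hi])
  have hsurv : c.noiseSurvival Q star u s ≤
      ∑ y : Fin (c.A + n - 1) → Y, (∏ i, (Q star (y i)).toReal) *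
        (if s < c.τ u y + n then (1 : ℝ) else 0) := by
    refine Finset.sum_le_sum fun y _ => mul_le_mul_of_nonneg_left ?_
      (Finset.prod_nonneg fun j _ => ENNReal.toReal_nonneg)
    split_ifs <;> first | (exfalso; omega) | norm_num
  calc _ ≤ (∏ i ∈ W, ∑ v, w' i v) * ∑ y : Fin (c.A + n - 1) → Y,
        (∏ i, (Q star (y i)).toReal) * (if s < c.τ u y + n then (1 : ℝ) else 0) :=
        mul_le_mul hprod hsurv (noiseSurvival_nonneg u s) ((Real.exp_pos _).le.trans hprod)
    _ = _ := hfac.symm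
    _ ≤ _ := by
        refine Finset.sum_le_sum fun y _ => ?_
        have hP : 0 ≤ ∏ i, (Q star (y i)).toReal :=
          Finset.prod_nonneg fun j _ => ENNReal.toReal_nonneg
        by_cases hy : ∀ i ∈ W, y i = y₀ i
        · have h1 : ∏ i, w' i (y i) = ∏ i, (Q star (y i)).toReal :=
            Finset.prod_congr rfl fun i _ => by
              simp only [hw']
              rw [if_neg fun h => h.2 (hy i h.1)]
          rw [h1]
          refine mul_le_mul_of_nonneg_left ?_ hP
          by_cases h2 : s < c.τ u y + n
          · have h3 : c.τ u y ≤ s := by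
              by_contra h4
              have := (hwin u s y₀ y (fun i h5 h6 => (hy i (by simp [hW, h5, h6])).symm)
                hs.le (not_le.mp h4).le).1 rfl
              omega
            simp [h2, h3]
          · simp [h2]
        · push Not at hy
          obtain ⟨i, hi, hne⟩ := hy
          rw [Finset.prod_eq_zero (Finset.mem_univ i) (by simp [hw', hi, hne]), zero_mul]
          exact mul_nonneg hP (by split_ifs <;> norm_num)

open Classical in
/-- Under pure noise a sliding-window rule cannot survive many times at which it may stop. -/
theorem HasWindowStopping.sum_noiseSurvival_le {k : ℕ} (hwin : c.HasWindowStopping k)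
    (hn : 1 ≤ n) {μ : ℝ} (hμ0 : 0 ≤ μ) (hμ : ∀ v, Real.exp (-μ) ≤ (Q star v).toReal)
    (u : Fin c.K) :
    ∑ s ∈ Finset.univ.image (c.τ u), c.noiseSurvival Q star u s ≤ n * Real.exp (μ * k) := by
  have h1 : ∑ s ∈ Finset.univ.image (c.τ u), Real.exp (-(μ * k)) * c.noiseSurvival Q star u s ≤
      n := by
    calc _ ≤ ∑ s ∈ Finset.univ.image (c.τ u), ∑ y : Fin (c.A + n - 1) → Y,
          (∏ i, (Q star (y i)).toReal) *
          (if c.τ u y ≤ s ∧ s < c.τ u y + n then (1 : ℝ) else 0) := by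
          refine Finset.sum_le_sum fun s hs => ?_
          obtain ⟨y₀, -, rfl⟩ := Finset.mem_image.mp hs
          exact hwin.exp_mul_noiseSurvival_le hn hμ0 hμ u y₀
      _ ≤ ∑ y : Fin (c.A + n - 1) → Y, (∏ i, (Q star (y i)).toReal) * n := by
          rw [Finset.sum_comm]
          refine Finset.sum_le_sum fun y _ => ?_
          rw [← Finset.mul_sum]
          refine mul_le_mul_of_nonneg_left ?_
            (Finset.prod_nonneg fun j _ => ENNReal.toReal_nonneg)
          -- Each output sequence is counted for at most `n` values of `s`.
          rw [← Finset.sum_filter, Finset.sum_const, nsmul_eq_mul, mul_one, Nat.cast_le]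
          calc _ ≤ (Finset.Ico (c.τ u y) (c.τ u y + n)).card :=
                Finset.card_le_card fun s hs => by
                  simpa using (Finset.mem_filter.mp hs).2
            _ = n := by simp
      _ = n := by
          rw [← Finset.sum_mul, sum_prod_eq_one (fun _ v => (Q star v).toReal)
            fun _ => sum_toReal_pmf _, one_mul]
  rw [← Finset.mul_sum] at h1
  have h2 := mul_le_mul_of_nonneg_left h1 (Real.exp_pos (μ * k)).le
  rw [← mul_assoc, ← Real.exp_add, add_neg_cancel, Real.exp_zero, one_mul] at h2
  linarith

/-- Whether the decoder stops before `t` is determined by Y_1, …, Y_{t-1}, which are pure noise when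
transmission starts at `t`. -/
theorem prob_le_τ_eq_noiseSurvival (u : Fin c.K) (m : Fin c.M) (t : ℕ) :
    ∑ y : Fin (c.A + n - 1) → Y, (∏ i, (Q (c.input star m t i) (y i)).toReal) *
      (if t ≤ c.τ u y then (1 : ℝ) else 0) = c.noiseSurvival Q star u t := by
  rcases t with _ | t
  · simp only [Nat.zero_le, if_true, mul_one, noiseSurvival]
    rw [sum_prod_eq_one _ fun i => sum_toReal_pmf _, sum_prod_eq_one (fun _ v => _)
      fun i => sum_toReal_pmf _]
  · refine sum_prod_mul_congr _ (fun _ v => (Q star v).toReal)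
      (fun i v => (Q (c.input star m (t + 1) i) v).toReal) _
      ((c.isStopping_τ u).dependsOn_indicator_lt t) (fun i => sum_toReal_pmf _)
      (fun i => sum_toReal_pmf _) fun i hi => ?_
    simp only [Set.mem_ofPred_eq] at hi
    rw [c.input_eq_star_of_lt star m (by omega)]

open Classical in
/-- Stopping within `[t, t + L]` requires surviving the noise until the first time from `t` on at
which the decoder may stop. -/
theorem prob_stop_near_le (u : Fin c.K) (m : Fin c.M) (t L : ℕ) :
    ∑ y : Fin (c.A + n - 1) → Y, (∏ i, (Q (c.input star m t i) (y i)).toReal) *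
      (if t ≤ c.τ u y ∧ c.τ u y ≤ t + L then (1 : ℝ) else 0) ≤
    ∑ s ∈ Finset.univ.image (c.τ u),
      if t ≤ s ∧ s ≤ t + L then c.noiseSurvival Q star u s else 0 := by
  have hnn : ∀ s ∈ Finset.univ.image (c.τ u),
      0 ≤ if t ≤ s ∧ s ≤ t + L then c.noiseSurvival Q star u s else 0 := fun s _ => by
    split_ifs; exacts [noiseSurvival_nonneg u s, le_rfl]
  by_cases hex : ∃ s, t ≤ s ∧ ∃ y, c.τ u y = s
  · obtain ⟨h1, y₀, h2⟩ := Nat.find_spec hex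
    have hmin : ∀ y, t ≤ c.τ u y → Nat.find hex ≤ c.τ u y := fun y hy =>
      Nat.find_min' hex ⟨hy, y, rfl⟩
    set s₀ := Nat.find hex
    by_cases hL : s₀ ≤ t + L
    · refine le_trans ?_ (Finset.single_le_sum hnn
        (Finset.mem_image.mpr ⟨y₀, Finset.mem_univ _, h2⟩))
      rw [if_pos ⟨h1, hL⟩]
      -- By minimality of `s₀` no stop is possible from `t` until just before `s₀`.
      have h3 : c.noiseSurvival Q star u s₀ = c.noiseSurvival Q star u t := by
        unfold noiseSurvival
        refine Finset.sum_congr rfl fun y _ => ?_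
        have : s₀ ≤ c.τ u y ↔ t ≤ c.τ u y := ⟨h1.trans, hmin y⟩
        simp only [this]
      rw [h3, ← prob_le_τ_eq_noiseSurvival u m t]
      refine Finset.sum_le_sum fun y _ => mul_le_mul_of_nonneg_left ?_
        (Finset.prod_nonneg fun j _ => ENNReal.toReal_nonneg)
      split_ifs <;> first | (exfalso; omega) | norm_num
    · refine le_trans (le_of_eq ?_) (Finset.sum_nonneg hnn)
      refine Finset.sum_eq_zero fun y _ => ?_
      rw [if_neg fun h => hL ((hmin y h.1).trans h.2), mul_zero]
  · refine le_trans (le_of_eq ?_) (Finset.sum_nonneg hnn)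
    refine Finset.sum_eq_zero fun y _ => ?_
    rw [if_neg fun h => hex ⟨_, h.1, y, rfl⟩, mul_zero]

-- A possible stopping time `s` is charged only by the start times in [s - L, s], of which there are
-- at most L + 1.
open Classical in
theorem HasWindowStopping.sum_expect_stop_near_le {k : ℕ} (hwin : c.HasWindowStopping k)
    (hn : 1 ≤ n) {μ : ℝ} (hμ0 : 0 ≤ μ) (hμ : ∀ v, Real.exp (-μ) ≤ (Q star v).toReal)
    (m : Fin c.M) (L : ℕ) :
    ∑ t ∈ Finset.Icc 1 c.A, c.expect Q star m t
      (fun u y => if t ≤ c.τ u y ∧ c.τ u y ≤ t + L then (1 : ℝ) else 0) ≤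
    (L + 1) * (n * Real.exp (μ * k)) := by
  have hu : ∀ u : Fin c.K, ∑ t ∈ Finset.Icc 1 c.A, ∑ y : Fin (c.A + n - 1) → Y,
      (∏ i, (Q (c.input star m t i) (y i)).toReal) *
      (if t ≤ c.τ u y ∧ c.τ u y ≤ t + L then (1 : ℝ) else 0) ≤
      (L + 1) * (n * Real.exp (μ * k)) := by
    intro u
    refine (Finset.sum_le_sum fun t _ => prob_stop_near_le u m t L).trans ?_
    rw [Finset.sum_comm]
    refine le_trans ?_ (mul_le_mul_of_nonneg_left (hwin.sum_noiseSurvival_le hn hμ0 hμ u)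
      (by positivity))
    rw [Finset.mul_sum]
    refine Finset.sum_le_sum fun s _ => ?_
    rw [← Finset.sum_filter, Finset.sum_const, nsmul_eq_mul]
    refine mul_le_mul_of_nonneg_right ?_ (noiseSurvival_nonneg u s)
    have : ((Finset.Icc 1 c.A).filter fun t => t ≤ s ∧ s ≤ t + L).card ≤ L + 1 := by
      calc _ ≤ (Finset.Icc (s - L) s).card := Finset.card_le_card fun t ht => by
              have := (Finset.mem_filter.mp ht).2
              rw [Finset.mem_Icc]; omega
        _ ≤ L + 1 := by rw [Nat.card_Icc]; omega
    exact_mod_cast this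
  unfold expect
  rw [Finset.sum_comm]
  calc _ ≤ ∑ u, (c.seedLaw u).toReal * ((L + 1) * (n * Real.exp (μ * k))) := by
        refine Finset.sum_le_sum fun u _ => ?_
        rw [← Finset.mul_sum]
        exact mul_le_mul_of_nonneg_left (hu u) ENNReal.toReal_nonneg
    _ = _ := by rw [← Finset.sum_mul, sum_toReal_pmf, one_mul]

/-- A training-based code with small error probability and delay operates at a limited asynchronism
level. -/
theorem HasWindowStopping.asynchronism_le {k : ℕ} (hwin : c.HasWindowStopping k)
    (hpre : c.HasCommonPreamble k) (hn : 1 ≤ n) {μ : ℝ} (hμ0 : 0 ≤ μ)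
    (hμ : ∀ v, Real.exp (-μ) ≤ (Q star v).toReal) {L : ℕ} (hL : 1 ≤ L) :
    c.A * (1 - 2 * c.errorProb Q star - c.delay Q star / L) ≤
      (L + 1) * (n * Real.exp (μ * k)) := by
  classical
  set m₀ : Fin c.M := ⟨0, c.M_pos⟩
  have hL0 : (0 : ℝ) < L := by exact_mod_cast hL
  refine le_trans ?_ (hwin.sum_expect_stop_near_le hn hμ0 hμ m₀ L)
  -- Failure means stopping before t + k, which costs error, or after t + L, which Markov's
  -- inequality bounds by the delay.
  have hpt : ∀ t, 1 - 2 * c.avgError Q star t - (1 / (L : ℝ)) *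
      c.expect Q star m₀ t (fun u y => max 0 ((c.τ u y : ℝ) - (t : ℝ))) ≤
      c.expect Q star m₀ t
      (fun u y => if t ≤ c.τ u y ∧ c.τ u y ≤ t + L then (1 : ℝ) else 0) := by
    intro t
    have h1 := hpre.expect_stop_le Q star m₀ t
    have h2 := c.expect_mono Q star m₀ t
      (f := fun u y => (1 - if c.τ u y < t + k then (1 : ℝ) else 0) -
        (1 / (L : ℝ)) * max 0 ((c.τ u y : ℝ) - (t : ℝ)))
      (g := fun u y => if t ≤ c.τ u y ∧ c.τ u y ≤ t + L then (1 : ℝ) else 0) fun u y => by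
        have h3 : 0 ≤ (1 / (L : ℝ)) * max 0 ((c.τ u y : ℝ) - (t : ℝ)) :=
          mul_nonneg (by positivity) (le_max_left _ _)
        by_cases h4 : c.τ u y < t + k
        · rw [if_pos h4]
          split_ifs <;> linarith
        · rw [if_neg h4]
          by_cases h5 : c.τ u y ≤ t + L
          · rw [if_pos ⟨by omega, h5⟩]; linarith
          · rw [if_neg fun h => h5 h.2]
            have h6 : ((t + L : ℕ) : ℝ) ≤ c.τ u y := by exact_mod_cast (not_le.mp h5).le
            push_cast at h6
            have h7 : (L : ℝ) ≤ max 0 ((c.τ u y : ℝ) - (t : ℝ)) :=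
              le_trans (by linarith) (le_max_right _ _)
            have h8 := mul_le_mul_of_nonneg_left h7 (by positivity : 0 ≤ 1 / (L : ℝ))
            rw [one_div_mul_cancel hL0.ne'] at h8
            linarith
    rw [expect_sub, expect_sub, expect_const, expect_const_mul] at h2
    linarith
  refine le_trans ?_ (Finset.sum_le_sum fun t _ => hpt t)
  rw [Finset.sum_sub_distrib, Finset.sum_sub_distrib, ← Finset.mul_sum, ← Finset.mul_sum]
  simp only [Finset.sum_const, Nat.card_Icc, add_tsub_cancel_right, nsmul_eq_mul, mul_one]
  have h1 := c.sum_avgError_le Q star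
  have h2 := mul_le_mul_of_nonneg_left (c.sum_expect_le Q star m₀)
    (by positivity : 0 ≤ 1 / (L : ℝ))
  have h3 : (c.A : ℝ) * (1 - 2 * c.errorProb Q star - c.delay Q star / L) =
      c.A - 2 * (c.A * c.errorProb Q star) - 1 / L * (c.A * c.delay Q star) := by ring
  linarith

end FalseAlarm

end Code

/-! ### Asymptotics: the two constraints on η and their combination -/

section Exponent

variable {X Y : Type*} {Q : X → PMF Y} {star : X}

/-- The asynchronism exponent of a training-based scheme is limited by its preamble. -/
theorem Achieves.exponent_le [Fintype X] [Fintype Y] (hC : 0 < capacity Q) {μ : ℝ} (hμ0 : 0 ≤ μ)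
    (hμ : ∀ v, Real.exp (-μ) ≤ (Q star v).toReal) {c : ∀ n, Code X Y n} {R α η : ℝ}
    (hR : 0 < R) (hη0 : 0 ≤ η)
    (htr : ∀ᶠ n : ℕ in atTop,
      (c n).HasCommonPreamble ⌊η * n⌋₊ ∧ (c n).HasWindowStopping ⌊η * n⌋₊)
    (hach : Achieves Q star c R α) : α ≤ μ * η := by
  by_contra! hlt
  set δ := (α - μ * η) / 2 with hδ
  have hδ0 : 0 < δ := by linarith
  -- With Δ/L ≤ 1/4 below, the value 1/8 leaves the factor 1 - 2/8 - 1/4 = 1/2 in front of A.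
  set ε := min (1 / 8) (min (R / 2) δ)
  have hε0 : 0 < ε := by positivity
  have hε1 : ε ≤ 1 / 8 := min_le_left _ _
  have hε2 : ε ≤ R / 2 := (min_le_right _ _).trans (min_le_left _ _)
  have hε3 : ε ≤ δ := (min_le_right _ _).trans (min_le_right _ _)
  set C := capacity Q
  -- The constant in Δ ≤ Kn: ln M ≤ 2(1 + C)n, and the rate is at least R/2.
  set K := (4 / R) * (1 + C)
  have hK0 : 0 < K := by positivity
  have hlarge : ∀ᶠ n : ℕ in atTop, 12 * (4 * K + 2) / δ ^ 3 < n :=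
    tendsto_natCast_atTop_atTop.eventually_gt_atTop _
  obtain ⟨n, hpw, ⟨hA, hrate, herr⟩, hn, hbig⟩ :=
    (htr.and ((hach ε hε0).and ((eventually_ge_atTop 1).and hlarge))).exists
  obtain ⟨hpre, hwin⟩ := hpw
  have hn1 : (1 : ℝ) ≤ n := by exact_mod_cast hn
  have hΔ0 := (c n).delay_nonneg Q star
  have hlen := Code.one_sub_errorProb_mul_log_le_length (star := star) hC hpre hwin
  have hlogM : 0 ≤ Real.log (c n).M := Real.log_nonneg (by exact_mod_cast (c n).M_pos)
  have hlog2 : Real.log 2 ≤ 1 := by linarith [Real.log_two_lt_d9]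
  have hM : Real.log (c n).M ≤ 2 * (1 + C) * n := by
    have h1 : (1 / 2) * Real.log (c n).M ≤ (1 - (c n).errorProb Q star) * Real.log (c n).M :=
      mul_le_mul_of_nonneg_right (by linarith) hlogM
    nlinarith
  have hΔ : (c n).delay Q star ≤ K * n := by
    have h1 : R / 2 * (c n).delay Q star ≤ (R - ε) * (c n).delay Q star :=
      mul_le_mul_of_nonneg_right (by linarith) hΔ0
    have h2 : K * n = (2 * (1 + C) * n) / (R / 2) := by simp only [K]; field_simp; ring
    rw [h2, le_div_iff₀ (by positivity)]
    linarith
  set L := ⌈4 * K * n⌉₊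
  have hL1 : 4 * K * n ≤ L := Nat.le_ceil _
  have hL2 : (L : ℝ) < 4 * K * n + 1 := Nat.ceil_lt_add_one (by positivity)
  have hLpos : 0 < L := Nat.ceil_pos.mpr (by positivity)
  have hLpos' : (0 : ℝ) < L := by exact_mod_cast hLpos
  have hasy := hwin.asynchronism_le hpre hn hμ0 hμ hLpos
  have hdL : (c n).delay Q star / L ≤ 1 / 4 := by
    rw [div_le_iff₀ hLpos']; linarith
  have hA0 : (0 : ℝ) ≤ (c n).A := by positivity
  have hA2 : ((c n).A : ℝ) * (1 / 2) ≤
      (c n).A * (1 - 2 * (c n).errorProb Q star - (c n).delay Q star / L) :=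
    mul_le_mul_of_nonneg_left (by linarith) hA0
  have hk : Real.exp (μ * ⌊η * n⌋₊) ≤ Real.exp (μ * η * n) := by
    refine Real.exp_le_exp.mpr ?_
    rw [mul_assoc]
    exact mul_le_mul_of_nonneg_left (Nat.floor_le (by positivity)) hμ0
  have hrhs : ((L : ℝ) + 1) * (n * Real.exp (μ * ⌊η * n⌋₊)) ≤
      ((4 * K + 2) * n) * (n * Real.exp (μ * η * n)) := by
    refine mul_le_mul (by linarith) (mul_le_mul_of_nonneg_left hk (by positivity))
      (by positivity) (by positivity)
  have hexp : Real.exp (δ * n) * Real.exp (μ * η * n) ≤ (c n).A := by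
    refine le_trans ?_ hA
    rw [← Real.exp_add, ← add_mul]
    exact Real.exp_le_exp.mpr (mul_le_mul_of_nonneg_right (by linarith) (by positivity))
  have hfin : Real.exp (δ * n) ≤ 2 * (4 * K + 2) * n ^ 2 := by
    refine le_of_mul_le_mul_right ?_ (Real.exp_pos (μ * η * n))
    linarith
  -- The cubic term of the exponential already outgrows the quadratic bound `hfin`.
  have hcube := Real.pow_div_factorial_le_exp (δ * n) (by positivity) 3
  rw [div_lt_iff₀ (by positivity)] at hbig
  have h3 : ((Nat.factorial 3 : ℕ) : ℝ) = 6 := by norm_num [Nat.factorial]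
  rw [h3] at hcube
  have h4 : (n : ℝ) ^ 2 * (n * δ ^ 3) ≤ n ^ 2 * (12 * (4 * K + 2)) := by
    have : (δ * n) ^ 3 ≤ 6 * (2 * (4 * K + 2) * n ^ 2) := by linarith
    linarith [this, show (n : ℝ) ^ 2 * (n * δ ^ 3) = (δ * n) ^ 3 by ring]
  have := le_of_mul_le_mul_left h4 (by positivity)
  linarith

/-- The rate of a training-based scheme with a nontrivial preamble is limited by the part of the
codeword that follows the preamble. -/
theorem Achieves.rate_le [Fintype X] [Fintype Y] (hC : 0 < capacity Q)
    {c : ∀ n, Code X Y n} {R α η : ℝ} (hR : 0 < R) (hη0 : 0 < η) (hη1 : η ≤ 1)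
    (htr : ∀ᶠ n : ℕ in atTop,
      (c n).HasCommonPreamble ⌊η * n⌋₊ ∧ (c n).HasWindowStopping ⌊η * n⌋₊)
    (hach : Achieves Q star c R α) : R ≤ capacity Q * (1 - η) := by
  by_contra! hlt
  set C := capacity Q
  set δ := (R - C * (1 - η)) / 2 with hδ
  have hδ0 : 0 < δ := by linarith
  -- The third term ensures (1 - ε)(R - ε) ≥ R - ε(1 + R) ≥ R - δ.
  set ε := min (1 / 4) (min R (δ / (1 + R)))
  have hε0 : 0 < ε := by positivity
  have hε1 : ε ≤ 1 / 4 := min_le_left _ _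
  have hε2 : ε ≤ R := (min_le_right _ _).trans (min_le_left _ _)
  have hε3 : ε * (1 + R) ≤ δ :=
    (le_div_iff₀ (by positivity)).mp ((min_le_right _ _).trans (min_le_right _ _))
  have hlarge : ∀ᶠ n : ℕ in atTop, (2 * ((Real.log 2 + 2 * C) / δ) + 2) / η < n :=
    tendsto_natCast_atTop_atTop.eventually_gt_atTop _
  obtain ⟨n, ⟨hpre, hwin⟩, ⟨-, hrate, herr⟩, hbig⟩ :=
    (htr.and ((hach ε hε0).and hlarge)).exists
  have hΔ0 := (c n).delay_nonneg Q star
  have hinfo := Code.one_sub_errorProb_mul_log_le_delay (star := star) hC hη0.le hη1 hpre hwin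
  have hdelay := hpre.mul_le_delay Q star
  have hlogM : 0 ≤ Real.log (c n).M := Real.log_nonneg (by exact_mod_cast (c n).M_pos)
  set Δ := (c n).delay Q star
  have h1 : (1 - ε) * ((R - ε) * Δ) ≤ Real.log 2 + C * ((1 - η) * Δ + 2) :=
    (mul_le_mul_of_nonneg_left hrate (by linarith)).trans
      ((mul_le_mul_of_nonneg_right (by linarith) hlogM).trans hinfo)
  have h2 : (R - δ) * Δ ≤ (1 - ε) * ((R - ε) * Δ) := by
    rw [← mul_assoc]
    exact mul_le_mul_of_nonneg_right (by nlinarith) hΔ0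
  -- This bounds Δ independently of n, whereas Δ is at least half the preamble length, which grows
  -- since η > 0.
  have h3 : Δ * δ ≤ Real.log 2 + 2 * C := by
    have : (R - δ) * Δ = C * (1 - η) * Δ + Δ * δ := by rw [hδ]; ring
    linarith
  rw [← le_div_iff₀ hδ0] at h3
  have h4 : η * n < ⌊η * n⌋₊ + 1 := Nat.lt_floor_add_one _
  have h5 : (⌊η * n⌋₊ : ℝ) * (1 / 2) ≤ Δ :=
    (mul_le_mul_of_nonneg_left (by linarith) (by positivity)).trans hdelay
  rw [div_lt_iff₀ hη0] at hbig
  linarith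

theorem trainingCapacity_le [Fintype X] [Fintype Y] (hC : 0 < capacity Q) {μ : ℝ} (hμ0 : 0 ≤ μ)
    (hμ : ∀ v, Real.exp (-μ) ≤ (Q star v).toReal) {R : ℝ} (hR : 0 < R) (hRC : R ≤ capacity Q) :
    trainingCapacity Q star R ≤ ENNReal.ofReal (μ * (1 - R / capacity Q)) := by
  refine iSup₂_le fun α h => ?_
  obtain ⟨c, ⟨η, hη0, hη1, htr⟩, hach⟩ := h
  rw [← ENNReal.ofReal_coe_nnreal]
  refine ENNReal.ofReal_le_ofReal ?_
  have h1 := hach.exponent_le hC hμ0 hμ hR hη0 htr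
  have h0 : 0 ≤ 1 - R / capacity Q := by
    rw [sub_nonneg, div_le_one hC]; exact hRC
  -- For η = 0 the exponent bound alone gives α ≤ 0; the rate bound needs η > 0 to make the delay
  -- grow.
  rcases hη0.eq_or_lt with rfl | hη
  · exact h1.trans (by simpa using mul_nonneg hμ0 h0)
  · refine h1.trans (mul_le_mul_of_nonneg_left ?_ hμ0)
    have h2 := hach.rate_le hC hR hη hη1 htr
    have : R / capacity Q ≤ 1 - η := by rw [div_le_iff₀ hC]; linarith
    linarith

/-- Under a finite synchronization threshold the noise reaches every output. -/
theorem noise_ne_zero (hreach : ∀ y, ∃ x, Q x y ≠ 0) (hthr : syncThreshold Q star < ⊤) (y : Y) :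
    Q star y ≠ 0 := by
  intro h0
  obtain ⟨x, hx⟩ := hreach y
  have hdiv : divergence (Q x) (Q star) ≠ ⊤ :=
    ((le_iSup (fun x => divergence (Q x) (Q star)) x).trans_lt hthr).ne
  let _ : MeasurableSpace Y := ⊤
  -- Finite divergence gives absolute continuity, so an output that the noise never produces cannot
  -- be produced by `x` either.
  have hac := (InformationTheory.klDiv_ne_top_iff.mp hdiv).1
  have h1 : (Q star).toMeasure {y} = 0 := by
    rw [PMF.toMeasure_apply_singleton _ _ (MeasurableSpace.measurableSet_top), h0]
  have h2 := hac h1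
  rw [PMF.toMeasure_apply_singleton _ _ (MeasurableSpace.measurableSet_top)] at h2
  exact hx h2

theorem exists_m₂_eq_coe [Finite Y] (h : ∀ y, Q star y ≠ 0) :
    ∃ μ : ℝ, m₂ Q star = μ ∧ 0 ≤ μ ∧ ∀ v, Real.exp (-μ) ≤ (Q star v).toReal := by
  obtain ⟨y₁, -⟩ := (Q star).support_nonempty
  have : Nonempty Y := ⟨y₁⟩
  obtain ⟨y₀, hy₀⟩ := exists_eq_ciInf_of_finite (f := fun y => Q star y)
  have hpos : 0 < (Q star y₀).toReal :=
    ENNReal.toReal_pos (h y₀) ((Q star).apply_ne_top y₀)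
  refine ⟨-Real.log (Q star y₀).toReal, ?_, ?_, fun v => ?_⟩
  · rw [m₂, ← hy₀, ENNReal.log_pos_real (h y₀) ((Q star).apply_ne_top y₀), EReal.coe_neg]
  · rw [neg_nonneg]
    refine Real.log_nonpos hpos.le ?_
    simpa using ENNReal.toReal_mono ENNReal.one_ne_top ((Q star).coe_le_one y₀)
  · rw [neg_neg, Real.exp_log hpos]
    refine ENNReal.toReal_mono ((Q star).apply_ne_top v) ?_
    rw [hy₀]
    exact iInf_le (fun y => Q star y) v

end Exponent

end AsyncComm

end

theorem corollary4 {X Y : Type*} [Fintype X] [Fintype Y] (Q : X → PMF Y) (star : X)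
    (hreach : ∀ y, ∃ x, Q x y ≠ 0) (hC : 0 < AsyncComm.capacity Q)
    (hthr : AsyncComm.syncThreshold Q star < ⊤) :
    AsyncComm.m₂ Q star < ⊤ ∧
    (∀ R : ℝ, 0 < R → R ≤ AsyncComm.capacity Q →
      (AsyncComm.trainingCapacity Q star R : EReal) ≤
        AsyncComm.m₂ Q star * ((1 - R / AsyncComm.capacity Q : ℝ) : EReal)) ∧
    Tendsto (AsyncComm.trainingCapacity Q star) (𝓝[≤] AsyncComm.capacity Q) (𝓝 0) := by
  obtain ⟨μ, hm₂, hμ0, hμ⟩ := AsyncComm.exists_m₂_eq_coe (AsyncComm.noise_ne_zero hreach hthr)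
  have hbound := fun R (hR : 0 < R) hRC =>
    AsyncComm.trainingCapacity_le (star := star) hC hμ0 hμ hR hRC
  refine ⟨by rw [hm₂]; exact EReal.coe_lt_top μ, fun R hR hRC => ?_, ?_⟩
  · rw [hm₂, ← EReal.coe_mul]
    have h0 : 0 ≤ 1 - R / AsyncComm.capacity Q := by
      rw [sub_nonneg, div_le_one hC]; exact hRC
    refine (EReal.coe_ennreal_le_coe_ennreal_iff.mpr (hbound R hR hRC)).trans ?_
    rw [EReal.coe_ennreal_ofReal, max_eq_left (mul_nonneg hμ0 h0)]
  · have hlim : Tendsto (fun R => ENNReal.ofReal (μ * (1 - R / AsyncComm.capacity Q)))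
        (𝓝[≤] AsyncComm.capacity Q) (𝓝 0) := by
      have hcont : Continuous fun R => ENNReal.ofReal (μ * (1 - R / AsyncComm.capacity Q)) := by
        exact ENNReal.continuous_ofReal.comp (by fun_prop)
      have := hcont.tendsto (AsyncComm.capacity Q)
      rw [div_self hC.ne', sub_self, mul_zero, ENNReal.ofReal_zero] at this
      exact this.mono_left nhdsWithin_le_nhds
    refine tendsto_of_tendsto_of_tendsto_of_le_of_le' tendsto_const_nhds hlim
      (Eventually.of_forall fun _ => zero_le) ?_
    -- The bound requires R > 0, which holds near C because C > 0.
    filter_upwards [self_mem_nhdsWithin, nhdsWithin_le_nhds (lt_mem_nhds hC)] with R hRC hR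
    exact hbound R hR hRC
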